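/- Let $\underline k\le\bar k$ and $\underline u\le\bar u$ be real numbers. Let $k:\mathbb R\to[\underline k,\bar k]$ (a.e.) be in $L^\infty(\mathbb R)$ with finite total variation $\|k\|_{BV}$. Let $f=f(k,u)$ be defined on $[\underline k,\bar k]\times[\underline u,\bar u]$ such that: (i) for each $k$, $f(k,\cdot)\in C^3[\underline u,\bar u]$ is strictly convex, and $0<\gamma_1\le f_{uu}(k,u)\le\gamma_2$ for all $(k,u)$; (ii) for each $u$, $f(\cdot,u)\in C^2[\underline k,\bar k]$ with $f_{kk}\equiv 0$, and $f_u(\cdot,u)\in C^1[\underline k,\bar k]$; (iii) $f(k_1,\bar u)=f(k_2,\bar u)$ and $f(k_1,\underline u)=f(k_2,\underline u)$ for all $k_1,k_2\in[\underline k,\bar k]$. Write $\|f_u\|,\|f_k\|,\|f_{uk}\|,\|f_{ku}\|$ for the sup norms of these partial derivatives over $[\underline k,\bar k]\times[\underline u,\bar u]$ (where $f_{uk}=\partial_k f_u$ and $f_{ku}=\partial_u f_k$), $\|k\|$ for the $L^\infty$ norm of $k$, $C_{u_0}:=\max\{|\underline u|,|\bar u|\}$ and $a_+:=\max\{a,0\}$.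 Let $\Delta x,\Delta t>0$, $\lambda=\Delta t/\Delta x$, and consider a uniform grid with cell centres $x_j=x_0+j\Delta x$, $x_{j\pm1/2}=x_j\pm\frac12\Delta x$ ($j\in\mathbb Z$). Put $k_j=\frac1{\Delta x}\int_{x_{j-1/2}}^{x_{j+1/2}}k(x)\,dx$. Let $(u_j^n)_{j\in\mathbb Z}$ satisfy $u^n_j\in[\underline u,\bar u]$ for all $j$ (so $|u^n_j|\le C_{u_0}$), and let $(u^{n+1}_{j+1/2})_{j\in\mathbb Z}$ be obtained from it by one step of the second-order central scheme $$u^{n+1}_{j+\frac12}=\tfrac12(u^n_j+u^n_{j+1})-\tfrac18(\sigma^n_{j+1}-\sigma^n_j)-\lambda\big(f(k_{j+1},u^{n+\frac12}_{j+1})-f(k_j,u^{n+\frac12}_j)\big),\qquad u^{n+\frac12}_j=u^n_j-\tfrac\lambda2 f_u(k_j,u^n_j)\,\sigma^n_j,$$ $$\sigma^n_j=\operatorname{minmod}\big(u^n_{j+1}-u^n_j,\ \tfrac12(u^n_{j+1}-u^n_{j-1}),\ u^n_j-u^n_{j-1}\big),$$ where $\operatorname{minmod}(a,b,c)=\operatorname{sgn}(a)\min\{|a|,|b|,|c|\}$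 if $\operatorname{sgn}a=\operatorname{sgn}b=\operatorname{sgn}c$ and $0$ otherwise. Assume the CFL condition $$\lambda\|f_u\|\le\kappa\le\min\Big\{\frac{\gamma_1}{7500\,\gamma_2},\frac1{4000}\Big\}.$$ If $\sum_{j}(u^n_j-u^n_{j-1})_+^2<\infty$ (otherwise the right-hand side below is not finite), then the other two series below converge and $$\sum_{j\in\mathbb Z}\big(u^{n+1}_{j+\frac12}-u^{n+1}_{j-\frac12}\big)_+^2\le\sum_{j\in\mathbb Z}\big(u^n_j-u^n_{j-1}\big)_+^2-\frac1{500}\lambda\gamma_1\sum_{j\in\mathbb Z}\big(u^n_j-u^n_{j-1}\big)_+^3+\Psi\,\|k\|_{BV},$$ where $$\begin{aligned}\Psi={}&72\lambda^2C_{u_0}^2\|f_{uk}\|+114\lambda C_{u_0}^2\|f_{ku}\|+\big(708C_{u_0}^2+48\lambda\|f_u\|\big)\lambda^2\|f_u\|\|f_{uk}\|\\&+\big(48\lambda^2C_{u_0}\|k\|+132\lambda^2C_{u_0}^2\gamma_2\|f_u\|+64\lambda\|f_k\|\|k\|+88C_{u_0}\big)\lambda\|f_k\|.\end{aligned}$$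 -/

import Mathlib

open Set MeasureTheory
open scoped ENNReal

noncomputable section

/-! Partial derivatives of a flux `f k u`, given on a rectangle `K ×ˢ U` of closed intervals
(one-sided derivatives at the end points), and sup norms over that rectangle. -/

/-- The partial derivative `∂g/∂u` at `(k, u)`, where `u` ranges over `U`. -/
def partialU (U : Set ℝ) (g : ℝ → ℝ → ℝ) : ℝ → ℝ → ℝ :=
  fun k u => derivWithin (fun v => g k v) U u

/-- The partial derivative `∂g/∂k` at `(k, u)`, where `k` ranges over `K`. -/
def partialK (K : Set ℝ) (g : ℝ → ℝ → ℝ) : ℝ → ℝ → ℝ :=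
  fun k u => derivWithin (fun c => g c u) K k

/-- The sup norm of `g` over the rectangle `K ×ˢ U`. -/
def rectNorm (K U : Set ℝ) (g : ℝ → ℝ → ℝ) : ℝ :=
  sSup ((fun p : ℝ × ℝ => |g p.1 p.2|) '' (K ×ˢ U))

/-- The hypotheses on the flux `f : [klo, khi] × [ulo, uhi] → ℝ`. -/
structure IsConvexFlux (klo khi ulo uhi γ₁ γ₂ : ℝ) (f : ℝ → ℝ → ℝ) : Prop where
  contDiff_u : ∀ k ∈ Icc klo khi, ContDiffOn ℝ 3 (fun u => f k u) (Icc ulo uhi)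
  strictConvex : ∀ k ∈ Icc klo khi, StrictConvexOn ℝ (Icc ulo uhi) (fun u => f k u)
  gamma_pos : 0 < γ₁
  lower : ∀ k ∈ Icc klo khi, ∀ u ∈ Icc ulo uhi,
    γ₁ ≤ partialU (Icc ulo uhi) (partialU (Icc ulo uhi) f) k u
  upper : ∀ k ∈ Icc klo khi, ∀ u ∈ Icc ulo uhi,
    partialU (Icc ulo uhi) (partialU (Icc ulo uhi) f) k u ≤ γ₂
  contDiff_k : ∀ u ∈ Icc ulo uhi, ContDiffOn ℝ 2 (fun k => f k u) (Icc klo khi)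
  kk_eq_zero : ∀ u ∈ Icc ulo uhi, ∀ k ∈ Icc klo khi,
    partialK (Icc klo khi) (partialK (Icc klo khi) f) k u = 0
  contDiff_uk : ∀ u ∈ Icc ulo uhi,
    ContDiffOn ℝ 1 (fun k => partialU (Icc ulo uhi) f k u) (Icc klo khi)
  eq_at_hi : ∀ k₁ ∈ Icc klo khi, ∀ k₂ ∈ Icc klo khi, f k₁ uhi = f k₂ uhi
  eq_at_lo : ∀ k₁ ∈ Icc klo khi, ∀ k₂ ∈ Icc klo khi, f k₁ ulo = f k₂ ulo

/-- The total variation of (the almost everywhere class of) `k` on the real line: the infimum of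
the pointwise variations of its representatives. -/
def totalVar (k : ℝ → ℝ) : ℝ≥0∞ :=
  ⨅ (g : ℝ → ℝ) (_ : g =ᵐ[volume] k), eVariationOn g univ

/-- The total variation semi-norm `‖k‖_BV` as a real number. -/
def bvNorm (k : ℝ → ℝ) : ℝ := (totalVar k).toReal

/-- The `L^∞` norm of `k` as a real number. -/
def supNorm (k : ℝ → ℝ) : ℝ := (eLpNorm k ∞ volume).toReal

/-- The hypotheses on the coefficient: `k ∈ BV ∩ L^∞` with values in `[klo, khi]` a.e. -/
structure IsCoefficient (klo khi : ℝ) (k : ℝ → ℝ) : Prop where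
  memLp : MemLp k ∞ volume
  finite_var : totalVar k ≠ ∞
  mem_Icc : ∀ᵐ x ∂(volume : Measure ℝ), k x ∈ Icc klo khi

/-- The average of `k` over the cell `[x_j - dx/2, x_j + dx/2]` with centre `x_j = x₀ + j dx`. -/
def cellAverage (dx x₀ : ℝ) (k : ℝ → ℝ) (j : ℤ) : ℝ :=
  1 / dx * ∫ x in (x₀ + (j - 1 / 2) * dx)..(x₀ + (j + 1 / 2) * dx), k x

/-- The minmod function of three arguments. -/
def minmod (a b c : ℝ) : ℝ :=
  if Real.sign a = Real.sign b ∧ Real.sign b = Real.sign c then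
    Real.sign a * min |a| (min |b| |c|)
  else 0

/-- The minmod slope `σ_j` of the sequence `u`. -/
def mmSlope (u : ℤ → ℝ) (j : ℤ) : ℝ :=
  minmod (u (j + 1) - u j) (1 / 2 * (u (j + 1) - u (j - 1))) (u j - u (j - 1))

/-- The mid-time value `u_j^{n+1/2} = u_j - (λ/2) f_u(k_j, u_j) σ_j`. -/
def midValue (lam : ℝ) (U : Set ℝ) (f : ℝ → ℝ → ℝ) (kd u : ℤ → ℝ) (j : ℤ) : ℝ :=
  u j - lam / 2 * partialU U f (kd j) (u j) * mmSlope u j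

/-- One step of the staggered second-order central scheme, applied to the cell averages `u` with
discrete coefficient `kd`: the value at index `j` is `u^{n+1}_{j+1/2}`. -/
def schemeStep (lam : ℝ) (U : Set ℝ) (f : ℝ → ℝ → ℝ) (kd u : ℤ → ℝ) (j : ℤ) : ℝ :=
  1 / 2 * (u j + u (j + 1)) - 1 / 8 * (mmSlope u (j + 1) - mmSlope u j)
    - lam * (f (kd (j + 1)) (midValue lam U f kd u (j + 1)) - f (kd j) (midValue lam U f kd u j))

/-- The constant `Ψ` as a function of `λ`, `C_{u₀}`, `γ₂` and of the norms
`‖f_u‖`, `‖f_k‖`, `‖f_{uk}‖`, `‖f_{ku}‖`, `‖k‖`. -/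
def oslConst (lam C γ₂ nfu nfk nfuk nfku nk : ℝ) : ℝ :=
  72 * lam ^ 2 * C ^ 2 * nfuk + 114 * lam * C ^ 2 * nfku
    + (708 * C ^ 2 + 48 * lam * nfu) * lam ^ 2 * nfu * nfuk
    + (48 * lam ^ 2 * C * nk + 132 * lam ^ 2 * C ^ 2 * γ₂ * nfu
        + 64 * lam * nfk * nk + 88 * C) * lam * nfk

end

/-! Everything is reduced to the positive jumps p_j = max(u_{j+1} - u_j, 0). Let r_j be the slope
correction `recon`, φ_j the flux increment `jumpFlux`, and e = r + φ. A nonincreasing jump needs no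
expansion: up to a coefficient error the staggered value lies between its two neighbours. Hence each
new positive jump is at most (p_{j-1} + p_j)/2 - (e_j - e_{j-1}) plus increments of the coefficient
(`sq_jump_le`), and what remains is an ℓ² estimate for this averaged sequence, proved modulo
summable telescoping terms.

Squaring and summing by parts gives p_j² - (p_j - p_{j-1})²/4 + e_j (p_{j+1} - p_{j-1}) + (e_j -
e_{j-1})². The minmod part r alone is dissipative: it leaves a negative multiple of squared second
differences and of the product rise·fall at a peak (`telescopeLE_minmod_dissipation`). The flux part
is φ = v p - 4c² r up to a small remainder, v being the mean speed over the jump and c the cell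
speed. Summation by parts turns the transport term v_j p_j (p_{j+1} - p_{j-1}) into -(v_{j+1} - v_j)
p_j p_{j+1}. Strong convexity makes v increase by at least λγ₁(p_j + p_{j+1})/2 minus a coefficient
error, which is the source of the cubic decay. This gain is lost at an isolated peak, where the
product rise·fall replaces it (`telescopeLE_cubic_gain`).

All other terms are small. Either they carry a factor κ in front of the dissipation, or they have
size κ(λγ₂ p + μ)p² with μ the coefficient variation, and κγ₂ ≤ γ₁/7500 makes their first part a
fraction of the cubic gain.

The coefficient enters through f_kk = 0: f is affine in k, so jumps of k change f and f_u at most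
linearly, at rates ‖f_k‖ and ‖f_ku‖. The increments of the cell averages are summable, with sum at
most the total variation of k. -/

noncomputable section

/-! ### Telescoping inequalities -/

/-- `X ≤ Y` up to the increments of a summable sequence. -/
def TelescopeLE (X Y : ℤ → ℝ) : Prop :=
  ∃ H : ℤ → ℝ, Summable H ∧ ∀ j, X j ≤ Y j + (H j - H (j + 1))

theorem TelescopeLE.of_le {X Y : ℤ → ℝ} (h : ∀ j, X j ≤ Y j) : TelescopeLE X Y :=
  ⟨fun _ => 0, summable_zero, fun j => by simpa using h j⟩

theorem TelescopeLE.add {X Y X' Y' : ℤ → ℝ} (h : TelescopeLE X Y) (h' : TelescopeLE X' Y') :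
    TelescopeLE (fun j => X j + X' j) (fun j => Y j + Y' j) := by
  obtain ⟨H, hH, h⟩ := h
  obtain ⟨H', hH', h'⟩ := h'
  exact ⟨fun j => H j + H' j, hH.add hH', fun j => by have := h j; have := h' j; linarith⟩

theorem TelescopeLE.trans {X Y Z : ℤ → ℝ} (h : TelescopeLE X Y) (h' : TelescopeLE Y Z) :
    TelescopeLE X Z := by
  obtain ⟨H, hH, h⟩ := h
  obtain ⟨H', hH', h'⟩ := h'
  exact ⟨fun j => H j + H' j, hH.add hH', fun j => by have := h j; have := h' j; linarith⟩

theorem summable_int_shift {H : ℤ → ℝ} (hH : Summable H) (i : ℤ) :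
    Summable fun j => H (j + i) :=
  (Equiv.addRight i).summable_iff.2 hH

theorem tsum_int_shift (H : ℤ → ℝ) (i : ℤ) : ∑' j, H (j + i) = ∑' j, H j :=
  (Equiv.addRight i).tsum_eq H

theorem TelescopeLE.summable {X Y : ℤ → ℝ} (h : TelescopeLE X Y) (hX : ∀ j, 0 ≤ X j)
    (hY : Summable Y) : Summable X := by
  obtain ⟨H, hH, h⟩ := h
  exact Summable.of_nonneg_of_le hX h (hY.add (hH.sub (summable_int_shift hH 1)))

/-- A summable H has the same sum as its shift, so the increments contribute nothing; there are no
boundary terms at infinity. -/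
theorem TelescopeLE.tsum_le {X Y : ℤ → ℝ} (h : TelescopeLE X Y) (hX : Summable X)
    (hY : Summable Y) : ∑' j, X j ≤ ∑' j, Y j := by
  obtain ⟨H, hH, h⟩ := h
  have hs := summable_int_shift hH 1
  calc ∑' j, X j ≤ ∑' j, (Y j + (H j - H (j + 1))) := hX.tsum_le_tsum h (hY.add (hH.sub hs))
    _ = ∑' j, Y j := by
      rw [hY.tsum_add (hH.sub hs), hH.tsum_sub hs, tsum_int_shift H 1]; ring

/-! ### Square summable sequences -/

/-- Square summability of a real sequence indexed by the integers. -/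
def SqSummable (x : ℤ → ℝ) : Prop := Summable fun j => x j ^ 2

theorem SqSummable.shift {x : ℤ → ℝ} (hx : SqSummable x) (i : ℤ) :
    SqSummable fun j => x (j + i) :=
  summable_int_shift (H := fun j => x j ^ 2) hx i

theorem SqSummable.mono {x y : ℤ → ℝ} (hx : SqSummable x) (K : ℝ)
    (h : ∀ j, |y j| ≤ K * |x j|) : SqSummable y := by
  refine Summable.of_nonneg_of_le (fun j => sq_nonneg _) (fun j => ?_) (hx.mul_left (K ^ 2))
  have := pow_le_pow_left₀ (abs_nonneg _) (h j) 2
  rwa [mul_pow, sq_abs, sq_abs] at this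

theorem SqSummable.mul {x y : ℤ → ℝ} (hx : SqSummable x) (hy : SqSummable y) :
    Summable fun j => x j * y j := by
  refine Summable.of_norm_bounded (g := fun j => x j ^ 2 + y j ^ 2) (hx.add hy) fun j => ?_
  rw [Real.norm_eq_abs, abs_le]
  constructor <;> nlinarith [sq_nonneg (x j + y j), sq_nonneg (x j - y j), sq_nonneg (x j),
    sq_nonneg (y j)]

theorem SqSummable.add {x y : ℤ → ℝ} (hx : SqSummable x) (hy : SqSummable y) :
    SqSummable fun j => x j + y j := by
  have h := ((Summable.add hx hy).add ((hx.mul hy).mul_left 2))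
  refine h.congr fun j => ?_
  ring

theorem SqSummable.bdd_mul {x c : ℤ → ℝ} (hx : SqSummable x) {K : ℝ} (hc : ∀ j, |c j| ≤ K) :
    SqSummable fun j => c j * x j :=
  hx.mono K fun j => by
    rw [abs_mul]; exact mul_le_mul_of_nonneg_right (hc j) (abs_nonneg _)

/-! ### Jumps of a nonnegative sequence -/

/-- The positive part of the backward difference. -/
def rise (p : ℤ → ℝ) (j : ℤ) : ℝ := max (p j - p (j - 1)) 0

/-- The negative part of the backward difference. -/
def fall (p : ℤ → ℝ) (j : ℤ) : ℝ := max (p (j - 1) - p j) 0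

/-- The reconstruction flux of the minmod slopes. -/
def recon (p : ℤ → ℝ) (j : ℤ) : ℝ := 1 / 8 * (rise p j - fall p (j + 1))

theorem rise_nonneg (p : ℤ → ℝ) (j : ℤ) : 0 ≤ rise p j := le_max_right _ _

theorem fall_nonneg (p : ℤ → ℝ) (j : ℤ) : 0 ≤ fall p j := le_max_right _ _

theorem rise_sub_fall (p : ℤ → ℝ) (j : ℤ) : rise p j - fall p j = p j - p (j - 1) := by
  unfold rise fall
  rcases le_total (p j) (p (j - 1)) with h | h
  · rw [max_eq_right (by linarith), max_eq_left (by linarith)]; ring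
  · rw [max_eq_left (by linarith), max_eq_right (by linarith)]; ring

theorem rise_mul_fall (p : ℤ → ℝ) (j : ℤ) : rise p j * fall p j = 0 := by
  unfold rise fall
  rcases le_total (p j) (p (j - 1)) with h | h
  · rw [max_eq_right (by linarith)]; ring
  · rw [max_eq_right (a := p (j - 1) - p j) (by linarith)]; ring

theorem rise_le {p : ℤ → ℝ} (hp : ∀ j, 0 ≤ p j) (j : ℤ) : rise p j ≤ p j :=
  max_le (by linarith [hp (j - 1)]) (hp j)

theorem fall_le {p : ℤ → ℝ} (hp : ∀ j, 0 ≤ p j) (j : ℤ) : fall p j ≤ p (j - 1) :=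
  max_le (by linarith [hp j]) (hp (j - 1))

theorem abs_recon_le {p : ℤ → ℝ} (hp : ∀ j, 0 ≤ p j) (j : ℤ) : |recon p j| ≤ 1 / 8 * p j := by
  have h1 := rise_le hp j
  have h2 := fall_le hp (j + 1)
  rw [add_sub_cancel_right] at h2
  have h3 := rise_nonneg p j
  have h4 := fall_nonneg p (j + 1)
  unfold recon
  rw [abs_le]; constructor <;> linarith

theorem SqSummable.rise {p : ℤ → ℝ} (hs : SqSummable p) (hp : ∀ j, 0 ≤ p j) :
    SqSummable (rise p) :=
  hs.mono 1 fun j => by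
    rw [abs_of_nonneg (rise_nonneg p j), abs_of_nonneg (hp j), one_mul]; exact rise_le hp j

theorem SqSummable.fall {p : ℤ → ℝ} (hs : SqSummable p) (hp : ∀ j, 0 ≤ p j) :
    SqSummable (fall p) :=
  (hs.shift (-1)).mono 1 fun j => by
    rw [abs_of_nonneg (fall_nonneg p j), abs_of_nonneg (hp _), one_mul]; exact fall_le hp j

theorem SqSummable.recon {p : ℤ → ℝ} (hs : SqSummable p) (hp : ∀ j, 0 ≤ p j) :
    SqSummable (recon p) :=
  hs.mono (1 / 8) fun j => by rw [abs_of_nonneg (hp j)]; exact abs_recon_le hp j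

/-- The second-difference dissipation. -/
def dissip (p : ℤ → ℝ) (j : ℤ) : ℝ :=
  (rise p j - rise p (j - 1)) ^ 2 + (fall p (j + 1) - fall p j) ^ 2

theorem sq_recon_sub_le (p : ℤ → ℝ) (j : ℤ) :
    (recon p j - recon p (j - 1)) ^ 2 ≤ 1 / 32 * dissip p j := by
  unfold recon dissip
  rw [sub_add_cancel]
  nlinarith [sq_nonneg ((rise p j - rise p (j - 1)) + (fall p (j + 1) - fall p j))]

/-! ### Quadratic identities: dissipation, transport, cubic gain -/

/-- Summation by parts for the square of an averaged and corrected sequence. -/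
theorem telescopeLE_sq_average {p e : ℤ → ℝ} (hp : SqSummable p) (he : SqSummable e) :
    TelescopeLE (fun j => (1 / 2 * (p (j - 1) + p j) - (e j - e (j - 1))) ^ 2)
      (fun j => p j ^ 2 - 1 / 4 * (p j - p (j - 1)) ^ 2 + e j * (p (j + 1) - p (j - 1))
        + (e j - e (j - 1)) ^ 2) := by
  refine ⟨fun j => 1 / 2 * p (j - 1) ^ 2 + (p (j - 1) + p j) * e (j - 1), ?_, fun j => ?_⟩
  · exact (Summable.mul_left _ (hp.shift (-1))).add (((hp.shift (-1)).add hp).mul (he.shift (-1)))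
  · simp only [add_sub_cancel_right]
    apply le_of_eq; ring

/-- The letters are consecutive rises (`am`, `a`, `ap`) and falls (`b`, `bp`). The product `am * bp`
in the expanded square joins indices two apart and does not telescope. Since `a` or `b` vanishes,
`key` trades it for `a * bp`, `am * b`, which cancel against the same square, and for part of the
dissipation. -/
theorem minmod_dissipation_pointwise {am a ap b bp : ℝ} (ha : 0 ≤ a)
    (hb : 0 ≤ b) (hab : a * b = 0) (habp : ap * bp = 0) :
    1 / 8 * (a - bp) * ((a - b) + (ap - bp)) + (1 / 8 * (a - bp) - 1 / 8 * (am - b)) ^ 2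
      - 1 / 4 * (a - b) ^ 2
    ≤ -(1 / 32) * ((a - am) ^ 2 + (bp - b) ^ 2) - 1 / 4 * (a * bp)
      + ((1 / 16 * am ^ 2 - 1 / 8 * (am * a) - 3 / 16 * b ^ 2)
        - (1 / 16 * a ^ 2 - 1 / 8 * (a * ap) - 3 / 16 * bp ^ 2)) := by
  have key : am * bp ≤ a * bp + am * b + 1 / 2 * ((a - am) ^ 2 + (bp - b) ^ 2) := by
    rcases mul_eq_zero.1 hab with h | h
    · subst h; nlinarith [sq_nonneg (am - (bp - b))]
    · subst h; nlinarith [sq_nonneg (am - a - bp), sq_nonneg (am - a + bp)]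
  nlinarith [key]

theorem telescopeLE_minmod_dissipation {p : ℤ → ℝ} (hp : SqSummable p) (h0 : ∀ j, 0 ≤ p j) :
    TelescopeLE
      (fun j => recon p j * (p (j + 1) - p (j - 1)) + (recon p j - recon p (j - 1)) ^ 2
        - 1 / 4 * (p j - p (j - 1)) ^ 2)
      (fun j => -(1 / 32) * dissip p j - 1 / 4 * (rise p j * fall p (j + 1))) := by
  have hr := hp.rise h0
  have hf := hp.fall h0
  refine ⟨fun j => 1 / 16 * rise p (j - 1) ^ 2 - 1 / 8 * (rise p (j - 1) * rise p j)
    - 3 / 16 * fall p j ^ 2, ?_, fun j => ?_⟩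
  · exact ((Summable.mul_left _ (hr.shift (-1))).sub (((hr.shift (-1)).mul hr).mul_left _)).sub
      (Summable.mul_left _ hf)
  · have h := minmod_dissipation_pointwise (am := rise p (j - 1)) (ap := rise p (j + 1))
      (bp := fall p (j + 1)) (rise_nonneg p j) (fall_nonneg p j) (rise_mul_fall p j)
      (rise_mul_fall p (j + 1))
    have h1 := rise_sub_fall p j
    have h2 := rise_sub_fall p (j + 1)
    rw [add_sub_cancel_right] at h2
    have h3 : p (j + 1) - p (j - 1)
        = (rise p j - fall p j) + (rise p (j + 1) - fall p (j + 1)) := by rw [h1, h2]; ring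
    unfold recon dissip
    simp only [add_sub_cancel_right, sub_add_cancel]
    rw [h3, ← h1]
    linarith [h]

/-- Shifting v_j p_j p_{j-1} by one index leaves -(v_{j+1} - v_j) p_j p_{j+1}. Only the growth of
the speed between two adjacent positive jumps matters, and this is where convexity yields decay. -/
theorem telescopeLE_transport {p v μ : ℤ → ℝ} {g κ W : ℝ} (hp : SqSummable p)
    (h0 : ∀ j, 0 ≤ p j) (hW : ∀ j, p j ≤ W) (hv : ∀ j, |v j| ≤ κ) (hμ : ∀ j, 0 ≤ μ j)
    (hmono : ∀ j, 0 < p j → 0 < p (j + 1) →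
      g / 2 * (p j + p (j + 1)) - μ j ≤ v (j + 1) - v j) :
    TelescopeLE (fun j => v j * p j * (p (j + 1) - p (j - 1)))
      (fun j => -(g / 2) * (p j * p (j + 1) * (p j + p (j + 1))) + W ^ 2 * μ j) := by
  refine ⟨fun j => -(v j * p j * p (j - 1)), ((hp.bdd_mul hv).mul (hp.shift (-1))).neg,
    fun j => ?_⟩
  simp only [add_sub_cancel_right]
  have hq : 0 ≤ p j * p (j + 1) := mul_nonneg (h0 j) (h0 _)
  have key : p j * p (j + 1) * (g / 2 * (p j + p (j + 1)) - μ j)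
      ≤ p j * p (j + 1) * (v (j + 1) - v j) := by
    rcases (h0 j).eq_or_lt with h | h
    · rw [← h]; simp
    rcases (h0 (j + 1)).eq_or_lt with h' | h'
    · rw [← h']; simp
    exact mul_le_mul_of_nonneg_left (hmono j h h') hq
  have hW2 : p j * p (j + 1) * μ j ≤ W ^ 2 * μ j := by
    refine mul_le_mul_of_nonneg_right ?_ (hμ j)
    rw [sq]; exact mul_le_mul (hW j) (hW _) (h0 _) ((h0 j).trans (hW j))
  nlinarith [key, hW2]

/-- For constant c the two terms of second order in c combine, after summation by parts, into c²
times squared second differences and the peak product. The variation of c² costs the terms with τ.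
-/
theorem telescopeLE_time_correction {p c τ : ℤ → ℝ} {κ : ℝ} (hp : SqSummable p)
    (h0 : ∀ j, 0 ≤ p j) (hc : ∀ j, |c j| ≤ κ) (hτ : ∀ j, 0 ≤ τ j)
    (hcc : ∀ j, 0 < p j → |c (j + 1) - c j| ≤ τ j) :
    TelescopeLE
      (fun j => c j ^ 2 * (p j - p (j - 1)) ^ 2
        - 4 * c j ^ 2 * recon p j * (p (j + 1) - p (j - 1)))
      (fun j => 2 * κ ^ 2 * dissip p j + κ ^ 2 * (rise p j * fall p (j + 1))
        + 2 * κ * τ (j - 1) * (p j ^ 2 + p (j - 1) ^ 2)) := by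
  have hκ : 0 ≤ κ := (abs_nonneg _).trans (hc 0)
  have hr := hp.rise h0
  have hf := hp.fall h0
  have hc' : ∀ j, |c (j + -1)| ≤ κ := fun j => hc _
  have hcsq : ∀ j, c j ^ 2 ≤ κ ^ 2 := fun j => sq_le_sq' (abs_le.1 (hc j)).1 (abs_le.1 (hc j)).2
  -- The last square moves the second difference of rises from index j + 1 back to j, where `dissip`
  -- has it.
  refine ⟨fun j => 1 / 4 * (c (j - 1) * rise p j) ^ 2 + 3 / 4 * (c (j - 1) * fall p j) ^ 2
      - 1 / 4 * (κ * (rise p j + -1 * rise p (j - 1))) ^ 2, ?_, fun j => ?_⟩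
  · have hκ' : ∀ j : ℤ, |κ| ≤ |κ| := fun _ => le_rfl
    have h1 : ∀ j : ℤ, |(-1 : ℝ)| ≤ 1 := fun _ => by simp
    have hd1 := ((hr.add ((hr.shift (-1)).bdd_mul h1)).bdd_mul hκ')
    exact ((Summable.mul_left _ (hr.bdd_mul hc')).add (Summable.mul_left _
      (hf.bdd_mul hc'))).sub (Summable.mul_left _ hd1)
  have e1 := rise_sub_fall p j
  have e2 := rise_sub_fall p (j + 1)
  rw [add_sub_cancel_right] at e2
  have e3 : p (j + 1) - p (j - 1)
      = (rise p j - fall p j) + (rise p (j + 1) - fall p (j + 1)) := by rw [e1, e2]; ring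
  have hdiff : 0 < p (j - 1) → c j ^ 2 - c (j - 1) ^ 2 ≤ 2 * κ * τ (j - 1) := by
    intro h
    have h1 := hcc (j - 1) h
    rw [sub_add_cancel] at h1
    calc c j ^ 2 - c (j - 1) ^ 2 ≤ |c j + c (j - 1)| * |c j - c (j - 1)| := by
          rw [← abs_mul]; refine le_trans (le_of_eq ?_) (le_abs_self _); ring
      _ ≤ (2 * κ) * τ (j - 1) := by
          refine mul_le_mul ?_ h1 (abs_nonneg _) (by linarith)
          linarith [abs_add_le (c j) (c (j - 1)), hc j, hc (j - 1)]
  have hA : (c j ^ 2 - c (j - 1) ^ 2) * rise p j ^ 2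
      ≤ κ ^ 2 * (rise p j - rise p (j - 1)) ^ 2 + 2 * κ * τ (j - 1) * p j ^ 2 := by
    -- If p_{j-1} = 0, nothing bounds c_j - c_{j-1}; but then the previous rise is zero, so the
    -- square of the rise is itself a squared second difference.
    rcases (h0 (j - 1)).eq_or_lt with h | h
    · have hz : rise p (j - 1) = 0 :=
        le_antisymm ((rise_le h0 _).trans h.symm.le) (rise_nonneg _ _)
      rw [hz, sub_zero]
      have : 0 ≤ 2 * κ * τ (j - 1) * p j ^ 2 := by have := hτ (j - 1); positivity
      nlinarith [hcsq j, sq_nonneg (c (j - 1)), sq_nonneg (rise p j)]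
    · have h1 : (c j ^ 2 - c (j - 1) ^ 2) * rise p j ^ 2 ≤ 2 * κ * τ (j - 1) * p j ^ 2 := by
        refine (mul_le_mul_of_nonneg_right (hdiff h) (sq_nonneg _)).trans ?_
        refine mul_le_mul_of_nonneg_left ?_ (by have := hτ (j - 1); positivity)
        exact pow_le_pow_left₀ (rise_nonneg p j) (rise_le h0 j) 2
      have : 0 ≤ κ ^ 2 * (rise p j - rise p (j - 1)) ^ 2 := by positivity
      linarith
  have hB : (c j ^ 2 - c (j - 1) ^ 2) * fall p j ^ 2 ≤ 2 * κ * τ (j - 1) * p (j - 1) ^ 2 := by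
    rcases (h0 (j - 1)).eq_or_lt with h | h
    · have hz : fall p j = 0 := le_antisymm ((fall_le h0 _).trans h.symm.le) (fall_nonneg _ _)
      rw [hz, ← h]; simp
    · refine (mul_le_mul_of_nonneg_right (hdiff h) (sq_nonneg _)).trans ?_
      refine mul_le_mul_of_nonneg_left ?_ (by have := hτ (j - 1); positivity)
      exact pow_le_pow_left₀ (fall_nonneg p j) (fall_le h0 j) 2
  have hC : c j ^ 2 * (rise p (j + 1) - rise p j) ^ 2
      ≤ κ ^ 2 * (rise p (j + 1) - rise p j) ^ 2 :=
    mul_le_mul_of_nonneg_right (hcsq j) (sq_nonneg _)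
  have hD : c j ^ 2 * (fall p (j + 1) - fall p j) ^ 2
      ≤ κ ^ 2 * (fall p (j + 1) - fall p j) ^ 2 :=
    mul_le_mul_of_nonneg_right (hcsq j) (sq_nonneg _)
  have hE : c j ^ 2 * (rise p j * fall p (j + 1)) ≤ κ ^ 2 * (rise p j * fall p (j + 1)) :=
    mul_le_mul_of_nonneg_right (hcsq j) (mul_nonneg (rise_nonneg _ _) (fall_nonneg _ _))
  have z1 := rise_mul_fall p j
  have z2 := rise_mul_fall p (j + 1)
  have hG1 : 0 ≤ κ ^ 2 * (rise p j - rise p (j - 1)) ^ 2 := by positivity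
  have hG2 : 0 ≤ κ ^ 2 * (fall p (j + 1) - fall p j) ^ 2 := by positivity
  have hT1 : 0 ≤ κ * τ (j - 1) * p j ^ 2 := by have := hτ (j - 1); positivity
  have hT2 : 0 ≤ κ * τ (j - 1) * p (j - 1) ^ 2 := by have := hτ (j - 1); positivity
  unfold recon dissip
  simp only [add_sub_cancel_right]
  rw [e3, ← e1]
  linear_combination (1 / 4) * hA + (3 / 4) * hB + (1 / 4) * hC + (1 / 4) * hD + hE
    + (3 / 2) * hG1 + (7 / 4) * hG2 + (3 / 2) * hT1 + (1 / 2) * hT2 - (3 / 2) * c j ^ 2 * z1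
    + c j ^ 2 * (1 / 2) * z2
-- After summation by parts the increments of w multiply squares of rises and falls with a minus
-- sign. An increasing w is therefore favourable, and the one-sided bound suffices.
theorem telescopeLE_cross {p w μ : ℤ → ℝ} {κ W : ℝ} (hp : SqSummable p)
    (h0 : ∀ j, 0 ≤ p j) (hW : ∀ j, p j ≤ W) (hw : ∀ j, |w j| ≤ κ) (hμ : ∀ j, 0 ≤ μ j)
    (hmono : ∀ j, 0 < p j → -μ j ≤ w (j + 1) - w j) :
    TelescopeLE
      (fun j => 2 * w j * (p j - p (j - 1)) * (recon p j - recon p (j - 1)))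
      (fun j => κ / 8 * dissip p j + κ / 2 * (rise p j * fall p (j + 1))
        + 1 / 8 * W ^ 2 * (μ j + μ (j - 1))) := by
  have hr := hp.rise h0
  have hf := hp.fall h0
  have hw' : ∀ j, |w (j + -1)| ≤ κ := fun j => hw _
  have hW0 : 0 ≤ W := (h0 0).trans (hW 0)
  refine ⟨fun j => -(1 / 8) * (w j * rise p (j - 1) * rise p (j - 1))
      - 1 / 8 * (w (j - 1) * fall p j * fall p j) + 1 / 4 * (w j * rise p (j - 1) * fall p j),
      ?_, fun j => ?_⟩
  · have hr' := (hr.shift (-1))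
    exact ((((hr'.bdd_mul hw).mul hr').mul_left _).sub (((hf.bdd_mul hw').mul hf).mul_left _)).add
      (((hr'.bdd_mul hw).mul hf).mul_left _)
  have e1 := rise_sub_fall p j
  have hA : -(w (j + 1) - w j) * rise p j ^ 2 ≤ W ^ 2 * μ j := by
    rcases (h0 j).eq_or_lt with h | h
    · have hz : rise p j = 0 := le_antisymm ((rise_le h0 _).trans h.symm.le) (rise_nonneg _ _)
      rw [hz]; have := hμ j; simp; positivity
    · have h1 := hmono j h
      have h2 : rise p j ^ 2 ≤ W ^ 2 :=
        pow_le_pow_left₀ (rise_nonneg p j) ((rise_le h0 j).trans (hW j)) 2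
      have h3 := mul_le_mul_of_nonneg_right (neg_le.1 h1) (sq_nonneg (rise p j))
      have h4 := mul_le_mul_of_nonneg_left h2 (hμ j)
      linarith
  have hB : -(w j - w (j - 1)) * fall p j ^ 2 ≤ W ^ 2 * μ (j - 1) := by
    rcases (h0 (j - 1)).eq_or_lt with h | h
    · have hz : fall p j = 0 := le_antisymm ((fall_le h0 _).trans h.symm.le) (fall_nonneg _ _)
      rw [hz]; have := hμ (j - 1); simp; positivity
    · have h1 := hmono (j - 1) h
      rw [sub_add_cancel] at h1
      have h2 : fall p j ^ 2 ≤ W ^ 2 :=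
        pow_le_pow_left₀ (fall_nonneg p j) ((fall_le h0 j).trans (hW _)) 2
      have h3 := mul_le_mul_of_nonneg_right (neg_le.1 h1) (sq_nonneg (fall p j))
      have h4 := mul_le_mul_of_nonneg_left h2 (hμ (j - 1))
      linarith
  have hC : w j * (rise p j - rise p (j - 1)) ^ 2 ≤ κ * (rise p j - rise p (j - 1)) ^ 2 :=
    mul_le_mul_of_nonneg_right (abs_le.1 (hw j)).2 (sq_nonneg _)
  have hD : -w j * (fall p (j + 1) - fall p j) ^ 2 ≤ κ * (fall p (j + 1) - fall p j) ^ 2 :=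
    mul_le_mul_of_nonneg_right (by linarith [(abs_le.1 (hw j)).1]) (sq_nonneg _)
  have hE : (w (j + 1) - w j) * (rise p j * fall p (j + 1))
      ≤ 2 * κ * (rise p j * fall p (j + 1)) :=
    mul_le_mul_of_nonneg_right
      (by linarith [(abs_le.1 (hw j)).1, (abs_le.1 (hw (j + 1))).2])
      (mul_nonneg (rise_nonneg _ _) (fall_nonneg _ _))
  unfold recon dissip
  simp only [add_sub_cancel_right, sub_add_cancel]
  rw [← e1]
  linear_combination (1 / 8) * hA + (1 / 8) * hB + (1 / 8) * hC + (1 / 8) * hD + (1 / 4) * hE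

/-- Half of the transport gain is shifted, so that p_j interacts with both neighbours. One neighbour
of size at least p_j/2 already gives (g/4)(3/4)p_j³. If both are smaller, rise and fall are each at
least p_j/2, and their product beats g p_j³ because g p_j ≤ 2κ. -/
theorem telescopeLE_cubic_gain {p : ℤ → ℝ} {g κ W : ℝ} (hp : SqSummable p)
    (h0 : ∀ j, 0 ≤ p j) (hW : ∀ j, p j ≤ W) (hg : 0 ≤ g) (hκ : κ ≤ 1 / 4000)
    (hgp : ∀ j, g * p j ≤ 2 * κ) :
    TelescopeLE
      (fun j => -(g / 2) * (p j * p (j + 1) * (p j + p (j + 1)))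
        - 1 / 8 * (rise p j * fall p (j + 1)))
      (fun j => -(3 / 16) * g * p j ^ 3) := by
  refine ⟨fun j => g / 4 * ((p (j - 1) + p j) * p (j - 1) * p j), ?_, fun j => ?_⟩
  · have hb : ∀ j, |p (j + -1) + p j| ≤ 2 * W := fun j => by
      rw [abs_of_nonneg (add_nonneg (h0 _) (h0 _))]; linarith [hW (j + -1), hW j]
    exact ((((hp.shift (-1)).bdd_mul hb).mul hp).mul_left _)
  simp only [add_sub_cancel_right]
  have hx := h0 (j - 1)
  have hy := h0 j
  have hz := h0 (j + 1)
  have ha := rise_nonneg p j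
  have hb := fall_nonneg p (j + 1)
  have hk := hgp j
  have hab : 0 ≤ rise p j * fall p (j + 1) := mul_nonneg ha hb
  have key : 3 / 16 * g * p j ^ 3 ≤ g / 4 * (p (j - 1) * p j * (p (j - 1) + p j))
      + g / 4 * (p j * p (j + 1) * (p j + p (j + 1))) + 1 / 8 * (rise p j * fall p (j + 1)) := by
    have half : ∀ x y : ℝ, 0 ≤ x → 0 ≤ y → y / 2 ≤ x → 3 / 4 * y ^ 3 ≤ y * x * (y + x) := by
      intro x y hx hy h
      have h1 : y / 2 * (3 / 2 * y) ≤ x * (y + x) :=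
        mul_le_mul h (by linarith) (by positivity) hx
      nlinarith [mul_le_mul_of_nonneg_left h1 hy]
    have t1 : 0 ≤ g / 4 * (p (j - 1) * p j * (p (j - 1) + p j)) := by positivity
    have t2 : 0 ≤ g / 4 * (p j * p (j + 1) * (p j + p (j + 1))) := by positivity
    rcases le_or_gt (p j / 2) (p (j - 1)) with h | h
    · have := mul_le_mul_of_nonneg_left (half _ _ hx hy h) (by positivity : 0 ≤ g / 4)
      nlinarith
    rcases le_or_gt (p j / 2) (p (j + 1)) with h' | h'
    · have := mul_le_mul_of_nonneg_left (half _ _ hz hy h') (by positivity : 0 ≤ g / 4)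
      nlinarith
    have r1 : p j / 2 ≤ rise p j := le_trans (by linarith) (le_max_left _ _)
    have r2 : p j / 2 ≤ fall p (j + 1) := by
      refine le_trans ?_ (le_max_left _ _)
      rw [add_sub_cancel_right]; linarith
    have r3 : p j / 2 * (p j / 2) ≤ rise p j * fall p (j + 1) :=
      mul_le_mul r1 r2 (by positivity) ha
    have r4 : g * p j * p j ^ 2 ≤ 2 * (1 / 4000) * p j ^ 2 :=
      mul_le_mul_of_nonneg_right (by linarith) (sq_nonneg _)
    nlinarith [sq_nonneg (p j)]
  linear_combination key

/-- The speed variation has two bounds: `T ≤ 4 * κ` lowers its square to T² ≤ 4κt, so the error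
stays linear in `t`, which will hold jump size and coefficient variation. The product E·z is split
by Young's inequality, whence 5/4 instead of 1. -/
theorem sq_perturbed_le {c E D z κ T t M : ℝ} (hc : |c| ≤ κ) (hκ : κ ≤ 1 / 4000)
    (hD : |D| ≤ M) (hT0 : 0 ≤ T) (hT : T ≤ 4 * κ) (hTt : T ≤ t)
    (hz : |z| ≤ 41 / 20 * T * M) :
    ((1 - 4 * c ^ 2) * E + c * D + z) ^ 2
      ≤ 5 / 4 * E ^ 2 + 2 * (c * (1 - 4 * c ^ 2)) * D * E + c ^ 2 * D ^ 2
        + 90 * (κ * t * M ^ 2) := by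
  have hκ0 : 0 ≤ κ := (abs_nonneg _).trans hc
  have hM : 0 ≤ M := (abs_nonneg _).trans hD
  have hc2 : c ^ 2 ≤ κ ^ 2 := sq_le_sq' (abs_le.1 hc).1 (abs_le.1 hc).2
  have hc3 : c ^ 2 ≤ 1 / 16000000 := by nlinarith
  have hf0 : 0 ≤ 1 - 4 * c ^ 2 := by linarith
  have hf1 : (1 - 4 * c ^ 2) ^ 2 ≤ 1 := by nlinarith [sq_nonneg c]
  have hTT : T * T ≤ 4 * κ * t := mul_le_mul hT hTt hT0 (by positivity)
  have hz2 : z ^ 2 ≤ (41 / 20) ^ 2 * (4 * κ * t) * M ^ 2 := by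
    have := pow_le_pow_left₀ (abs_nonneg z) hz 2
    rw [sq_abs] at this
    nlinarith [mul_le_mul_of_nonneg_right hTT (sq_nonneg M)]
  have hcD : c * D * z ≤ 41 / 20 * (κ * t * M ^ 2) := by
    calc c * D * z ≤ |c * D * z| := le_abs_self _
      _ = |c| * |D| * |z| := by rw [abs_mul, abs_mul]
      _ ≤ κ * M * (41 / 20 * t * M) := by
          refine mul_le_mul (mul_le_mul hc hD (abs_nonneg _) hκ0) (hz.trans ?_) (abs_nonneg _)
            (by positivity)
          gcongr
      _ = _ := by ring
  have hEz : 2 * ((1 - 4 * c ^ 2) * E) * z ≤ 1 / 4 * ((1 - 4 * c ^ 2) ^ 2 * E ^ 2) + 4 * z ^ 2 := by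
    nlinarith [sq_nonneg ((1 - 4 * c ^ 2) * E - 4 * z)]
  have hE : (1 - 4 * c ^ 2) ^ 2 * E ^ 2 ≤ 1 * E ^ 2 := mul_le_mul_of_nonneg_right hf1 (sq_nonneg _)
  have hpos : 0 ≤ κ * t * M ^ 2 := by
    have : 0 ≤ t := hT0.trans hTt
    positivity
  nlinarith

/-! ### The abstract convex step and its energy balance -/

/-- Estimates on the wave speeds and fluxes of one step of a central scheme for a convex flux:
`p` is the sequence of positive jumps, `c` the speeds at the cells, `v` the mean speeds over the
jumps, `φ` the flux increments, `τ` a bound for the speed differences over the jumps, `μ` the part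
of it caused by the coefficient. -/
structure ConvexStep (p c v φ τ μ : ℤ → ℝ) (κ g Λ W : ℝ) : Prop where
  p_nonneg : ∀ j, 0 ≤ p j
  p_le : ∀ j, p j ≤ W
  sqSummable : SqSummable p
  kappa_le : κ ≤ 1 / 4000
  g_nonneg : 0 ≤ g
  lam_nonneg : 0 ≤ Λ
  kappa_mul_le : κ * Λ ≤ g / 7500
  g_mul_le : ∀ j, g * p j ≤ 2 * κ
  c_le : ∀ j, |c j| ≤ κ
  v_le : ∀ j, |v j| ≤ κ
  mu_nonneg : ∀ j, 0 ≤ μ j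
  mu_summable : Summable μ
  tau_nonneg : ∀ j, 0 ≤ τ j
  tau_le : ∀ j, τ j ≤ 4 * κ
  tau_le' : ∀ j, τ j ≤ Λ * p j + μ j
  v_sub_left : ∀ j, 0 < p j → |v j - c j| ≤ τ j
  v_sub_right : ∀ j, 0 < p j → |v j - c (j + 1)| ≤ τ j
  c_sub : ∀ j, 0 < p j → |c (j + 1) - c j| ≤ τ j
  c_mono : ∀ j, 0 < p j → -μ j ≤ c (j + 1) - c j
  v_mono : ∀ j, 0 < p j → 0 < p (j + 1) → g / 2 * (p j + p (j + 1)) - μ j ≤ v (j + 1) - v j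
  phi_sub : ∀ j, |φ j - (v j * p j - 4 * c j ^ 2 * recon p j)| ≤ 2 * κ * τ j * p j

namespace ConvexStep

variable {p c v φ τ μ : ℤ → ℝ} {κ g Λ W : ℝ}

theorem kappa_nonneg (h : ConvexStep p c v φ τ μ κ g Λ W) : 0 ≤ κ := (abs_nonneg _).trans (h.c_le 0)

theorem abs_phi_le (h : ConvexStep p c v φ τ μ κ g Λ W) (j : ℤ) : |φ j| ≤ 1 / 8 * p j := by
  have hκ := h.kappa_nonneg
  have hκ1 := h.kappa_le
  have hp := h.p_nonneg j
  have h1 := h.phi_sub j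
  have h2 : |v j * p j| ≤ 1 / 4000 * p j := by
    rw [abs_mul, abs_of_nonneg hp]
    exact mul_le_mul_of_nonneg_right ((h.v_le j).trans hκ1) hp
  have hc2 : c j ^ 2 ≤ 1 / 4000 := by
    have := sq_le_sq' (abs_le.1 (h.c_le j)).1 (abs_le.1 (h.c_le j)).2
    nlinarith
  have h3 : |4 * c j ^ 2 * recon p j| ≤ 4 * (1 / 4000) * (1 / 8 * p j) := by
    rw [abs_mul, abs_of_nonneg (by positivity)]
    exact mul_le_mul (by linarith) (abs_recon_le h.p_nonneg j) (abs_nonneg _) (by norm_num)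
  have h4 : 2 * κ * τ j * p j ≤ 1 / 100 * p j := by
    refine mul_le_mul_of_nonneg_right ?_ hp
    have := mul_le_mul hκ1 (h.tau_le j) (h.tau_nonneg j) (by norm_num)
    linarith
  rw [abs_le] at *
  constructor <;> linarith [h1.1, h1.2, h2.1, h2.2, h3.1, h3.2]

/-- Cell j separates jumps j - 1 and j, so all speeds in e_j - e_{j-1} are frozen at c_j. The
difference becomes (1 - 4c_j²)(r_j - r_{j-1}) + c_j(p_j - p_{j-1}) + z, with z of size T·M, and
`sq_perturbed_le` applies. -/
theorem local_error (h : ConvexStep p c v φ τ μ κ g Λ W) (j : ℤ) {T t M : ℝ}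
    (hT : T ≤ 4 * κ) (hTt : T ≤ t) (hτ : τ j ≤ T) (hτ' : τ (j - 1) ≤ T)
    (hp₁ : p (j - 1) ≤ M) (hp₂ : p j ≤ M) (hp₃ : p (j + 1) ≤ M) :
    (recon p j + φ j) * (p (j + 1) - p (j - 1))
        + ((recon p j + φ j) - (recon p (j - 1) + φ (j - 1))) ^ 2
      ≤ recon p j * (p (j + 1) - p (j - 1)) + v j * p j * (p (j + 1) - p (j - 1))
        - 4 * c j ^ 2 * recon p j * (p (j + 1) - p (j - 1))
        + 5 / 4 * (recon p j - recon p (j - 1)) ^ 2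
        + 2 * (c j * (1 - 4 * c j ^ 2)) * (p j - p (j - 1)) * (recon p j - recon p (j - 1))
        + c j ^ 2 * (p j - p (j - 1)) ^ 2 + 92 * (κ * t * M ^ 2) := by
  have hκ := h.kappa_nonneg
  have hT0 : 0 ≤ T := (h.tau_nonneg j).trans hτ
  have ht0 : 0 ≤ t := hT0.trans hTt
  have hq₁ := h.p_nonneg (j - 1)
  have hq₂ := h.p_nonneg j
  have hq₃ := h.p_nonneg (j + 1)
  have hM : 0 ≤ M := hq₂.trans hp₂
  set ρ := φ j - (v j * p j - 4 * c j ^ 2 * recon p j) with hρ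
  set ρ' := φ (j - 1) - (v (j - 1) * p (j - 1) - 4 * c (j - 1) ^ 2 * recon p (j - 1)) with hρ'
  have hρb : |ρ| ≤ 2 * κ * T * M := (h.phi_sub j).trans (by gcongr)
  have hρb' : |ρ'| ≤ 2 * κ * T * M := (h.phi_sub (j - 1)).trans (by gcongr)
  set z := (v j - c j) * p j + (c j - v (j - 1)) * p (j - 1)
    - 4 * (c j ^ 2 - c (j - 1) ^ 2) * recon p (j - 1) + ρ - ρ' with hz
  -- Speed differences are controlled only over positive jumps; elsewhere the factor y removes them.
  have mulb : ∀ x y : ℝ, 0 ≤ y → y ≤ M → (0 < y → |x| ≤ T) → |x * y| ≤ T * M := by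
    intro x y hy hyM hx
    rcases hy.eq_or_lt with h0 | h0
    · rw [← h0, mul_zero, abs_zero]; positivity
    · rw [abs_mul, abs_of_nonneg hy]
      exact mul_le_mul (hx h0) hyM hy hT0
  have z1 : |(v j - c j) * p j| ≤ T * M :=
    mulb _ _ hq₂ hp₂ fun h0 => (h.v_sub_left j h0).trans hτ
  have z2 : |(c j - v (j - 1)) * p (j - 1)| ≤ T * M := by
    refine mulb _ _ hq₁ hp₁ fun h0 => ?_
    have := h.v_sub_right (j - 1) h0
    rw [sub_add_cancel, abs_sub_comm] at this
    exact this.trans hτ'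
  have z3 : |4 * (c j ^ 2 - c (j - 1) ^ 2) * recon p (j - 1)| ≤ κ * T * M := by
    have hm : |(c j - c (j - 1)) * p (j - 1)| ≤ T * M := by
      refine mulb _ _ hq₁ hp₁ fun h0 => ?_
      have := h.c_sub (j - 1) h0
      rw [sub_add_cancel] at this
      exact this.trans hτ'
    have hr := abs_recon_le h.p_nonneg (j - 1)
    have hs : |c j + c (j - 1)| ≤ 2 * κ := by
      linarith [abs_add_le (c j) (c (j - 1)), h.c_le j, h.c_le (j - 1)]
    rw [abs_mul, abs_of_nonneg hq₁] at hm
    calc |4 * (c j ^ 2 - c (j - 1) ^ 2) * recon p (j - 1)|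
        = 4 * |c j + c (j - 1)| * |c j - c (j - 1)| * |recon p (j - 1)| := by
          rw [show 4 * (c j ^ 2 - c (j - 1) ^ 2) * recon p (j - 1)
            = 4 * (c j + c (j - 1)) * (c j - c (j - 1)) * recon p (j - 1) by ring,
            abs_mul, abs_mul, abs_mul, abs_of_pos (by norm_num : (0 : ℝ) < 4)]
      _ ≤ 4 * (2 * κ) * |c j - c (j - 1)| * (1 / 8 * p (j - 1)) := by gcongr
      _ = κ * (|c j - c (j - 1)| * p (j - 1)) := by ring
      _ ≤ κ * T * M := by rw [mul_assoc]; exact mul_le_mul_of_nonneg_left hm hκ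
  have hTM : 0 ≤ T * M := by positivity
  have hκTM : κ * (T * M) ≤ 1 / 4000 * (T * M) := mul_le_mul_of_nonneg_right h.kappa_le hTM
  have hzb : |z| ≤ 41 / 20 * T * M := by
    rw [abs_le] at *
    constructor <;> linarith [z1.1, z1.2, z2.1, z2.2, z3.1, z3.2, hρb.1, hρb.2, hρb'.1, hρb'.2]
  have hD : |p j - p (j - 1)| ≤ M := by rw [abs_le]; constructor <;> linarith
  have hD' : |p (j + 1) - p (j - 1)| ≤ M := by rw [abs_le]; constructor <;> linarith
  have hsq := sq_perturbed_le (E := recon p j - recon p (j - 1)) (h.c_le j) h.kappa_le hD hT0 hT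
    hTt hzb
  have hρD : ρ * (p (j + 1) - p (j - 1)) ≤ 2 * (κ * t * M ^ 2) := by
    calc ρ * (p (j + 1) - p (j - 1)) ≤ |ρ| * |p (j + 1) - p (j - 1)| := by
          rw [← abs_mul]; exact le_abs_self _
      _ ≤ (2 * κ * T * M) * M := mul_le_mul hρb hD' (abs_nonneg _) (by positivity)
      _ ≤ (2 * κ * t * M) * M := by gcongr
      _ = _ := by ring
  have hexp : (recon p j + φ j) - (recon p (j - 1) + φ (j - 1))
      = (1 - 4 * c j ^ 2) * (recon p j - recon p (j - 1)) + c j * (p j - p (j - 1)) + z := by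
    rw [hz, hρ, hρ']; ring
  rw [hexp]
  have hφ : φ j = v j * p j - 4 * c j ^ 2 * recon p j + ρ := by rw [hρ]; ring
  rw [hφ]
  linarith

theorem summable_cube (h : ConvexStep p c v φ τ μ κ g Λ W) : Summable fun j => p j ^ 3 := by
  refine Summable.of_nonneg_of_le (fun j => pow_nonneg (h.p_nonneg j) 3) (fun j => ?_)
    (Summable.mul_left W h.sqSummable)
  rw [pow_succ, mul_comm]
  exact mul_le_mul_of_nonneg_right (h.p_le j) (sq_nonneg _)

/-- The sum of the local errors of `local_error` and `telescopeLE_time_correction`. -/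
theorem telescopeLE_error (h : ConvexStep p c v φ τ μ κ g Λ W) :
    TelescopeLE
      (fun j => (recon p j + φ j) * (p (j + 1) - p (j - 1))
        + ((recon p j + φ j) - (recon p (j - 1) + φ (j - 1))) ^ 2
        + 2 * κ * τ (j - 1) * (p j ^ 2 + p (j - 1) ^ 2))
      (fun j => recon p j * (p (j + 1) - p (j - 1)) + v j * p j * (p (j + 1) - p (j - 1))
        - 4 * c j ^ 2 * recon p j * (p (j + 1) - p (j - 1))
        + 5 / 4 * (recon p j - recon p (j - 1)) ^ 2
        + 2 * (c j * (1 - 4 * c j ^ 2)) * (p j - p (j - 1)) * (recon p j - recon p (j - 1))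
        + c j ^ 2 * (p j - p (j - 1)) ^ 2 + (1 / 25 * g * p j ^ 3 + 3 / 40 * W ^ 2 * μ j)) := by
  -- The error coefficient is 96 = 92 + 4 (local error and time correction), and 96/7500 ≤ 1/75,
  -- 96/4000 ≤ 1/40.
  set N : ℤ → ℝ := fun j => 1 / 75 * g * p j ^ 3 + 1 / 40 * W ^ 2 * μ j with hN
  have hNs : Summable N := (Summable.mul_left _ h.summable_cube).add (h.mu_summable.mul_left _)
  have hκ := h.kappa_nonneg
  have hg := h.g_nonneg
  have hΛ := h.lam_nonneg
  -- The error at j involves N at j - 1, j and j + 1; this witness replaces their sum by 3 N_j.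
  refine ⟨fun j => N (j - 1) - N j, (summable_int_shift hNs (-1)).sub hNs, fun j => ?_⟩
  obtain ⟨M, hM₁, hM₂, hM₃, hMW, hM3⟩ : ∃ M, p (j - 1) ≤ M ∧ p j ≤ M ∧ p (j + 1) ≤ M ∧ M ≤ W ∧
      M ^ 3 ≤ p (j - 1) ^ 3 + p j ^ 3 + p (j + 1) ^ 3 := by
    have q₁ := pow_nonneg (h.p_nonneg (j - 1)) 3
    have q₂ := pow_nonneg (h.p_nonneg j) 3
    have q₃ := pow_nonneg (h.p_nonneg (j + 1)) 3
    refine ⟨max (p (j - 1)) (max (p j) (p (j + 1))), le_max_left _ _,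
      (le_max_left _ _).trans (le_max_right _ _), (le_max_right _ _).trans (le_max_right _ _),
      max_le (h.p_le _) (max_le (h.p_le _) (h.p_le _)), ?_⟩
    rcases max_choice (p (j - 1)) (max (p j) (p (j + 1))) with e | e <;> rw [e]
    · linarith
    · rcases max_choice (p j) (p (j + 1)) with e | e <;> rw [e] <;> linarith
  have hM : 0 ≤ M := (h.p_nonneg j).trans hM₂
  set m := μ (j - 1) + μ j + μ (j + 1) with hm
  have m₁ := h.mu_nonneg (j - 1)
  have m₂ := h.mu_nonneg j
  have m₃ := h.mu_nonneg (j + 1)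
  have ht₁ : τ j ≤ Λ * M + m := (h.tau_le' j).trans (by
    linarith [mul_le_mul_of_nonneg_left hM₂ hΛ])
  have ht₂ : τ (j - 1) ≤ Λ * M + m := (h.tau_le' (j - 1)).trans (by
    linarith [mul_le_mul_of_nonneg_left hM₁ hΛ])
  have hloc := h.local_error j (T := max (τ j) (τ (j - 1))) (max_le (h.tau_le _) (h.tau_le _))
    (max_le ht₁ ht₂) (le_max_left _ _) (le_max_right _ _) hM₁ hM₂ hM₃
  have hextra : 2 * κ * τ (j - 1) * (p j ^ 2 + p (j - 1) ^ 2)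
      ≤ 4 * (κ * (Λ * M + m) * M ^ 2) := by
    have : p j ^ 2 + p (j - 1) ^ 2 ≤ 2 * M ^ 2 := by
      have := pow_le_pow_left₀ (h.p_nonneg j) hM₂ 2
      have := pow_le_pow_left₀ (h.p_nonneg (j - 1)) hM₁ 2
      linarith
    calc 2 * κ * τ (j - 1) * (p j ^ 2 + p (j - 1) ^ 2)
        ≤ 2 * κ * (Λ * M + m) * (2 * M ^ 2) := by
          have := h.tau_nonneg (j - 1)
          gcongr
      _ = _ := by ring
  have hm0 : 0 ≤ m := by positivity
  have herr : 96 * (κ * (Λ * M + m) * M ^ 2) ≤ N (j - 1) + N j + N (j + 1) := by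
    have i₁ : κ * Λ * M ^ 3 ≤ g / 7500 * (p (j - 1) ^ 3 + p j ^ 3 + p (j + 1) ^ 3) :=
      mul_le_mul h.kappa_mul_le hM3 (by positivity) (by positivity)
    have i₂ : κ * (m * M ^ 2) ≤ 1 / 4000 * (m * W ^ 2) := by
      have := h.kappa_le
      gcongr
    have e₁ := mul_nonneg hg (pow_nonneg (h.p_nonneg (j - 1)) 3)
    have e₂ := mul_nonneg hg (pow_nonneg (h.p_nonneg j) 3)
    have e₃ := mul_nonneg hg (pow_nonneg (h.p_nonneg (j + 1)) 3)
    have e₄ : 0 ≤ m * W ^ 2 := by positivity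
    have e₅ : N (j - 1) + N j + N (j + 1)
        = 1 / 75 * (g * p (j - 1) ^ 3 + g * p j ^ 3 + g * p (j + 1) ^ 3)
          + 1 / 40 * (m * W ^ 2) := by rw [hN, hm]; ring
    rw [e₅]
    nlinarith
  have e₆ : 1 / 25 * g * p j ^ 3 + 3 / 40 * W ^ 2 * μ j = 3 * N j := by rw [hN]; ring
  simp only [add_sub_cancel_right]
  rw [e₆]
  linarith

/-- One-sided `ℓ²` stability of the averaged sequence. -/
theorem telescopeLE_sq (h : ConvexStep p c v φ τ μ κ g Λ W) :
    TelescopeLE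
      (fun j => (1 / 2 * (p (j - 1) + p j)
        - ((recon p j + φ j) - (recon p (j - 1) + φ (j - 1)))) ^ 2)
      (fun j => p j ^ 2 - 1 / 500 * g * p j ^ 3 + 2 * W ^ 2 * μ j) := by
  have hκ := h.kappa_nonneg
  have hκ1 := h.kappa_le
  have hs := h.sqSummable
  have h0 := h.p_nonneg
  have he : SqSummable fun j => recon p j + φ j :=
    (hs.recon h0).add (hs.mono (1 / 8) fun j => by
      rw [abs_of_nonneg (h0 j)]; exact h.abs_phi_le j)
  have hw : ∀ j, |c j * (1 - 4 * c j ^ 2)| ≤ κ := fun j => by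
    have := sq_le_sq' (abs_le.1 (h.c_le j)).1 (abs_le.1 (h.c_le j)).2
    have h1 : 0 ≤ 1 - 4 * c j ^ 2 := by nlinarith
    rw [abs_mul, abs_of_nonneg h1]
    calc |c j| * (1 - 4 * c j ^ 2) ≤ |c j| * 1 :=
          mul_le_mul_of_nonneg_left (by nlinarith [sq_nonneg (c j)]) (abs_nonneg _)
      _ ≤ κ := by rw [mul_one]; exact h.c_le j
  have hwm : ∀ j, 0 < p j →
      -μ j ≤ c (j + 1) * (1 - 4 * c (j + 1) ^ 2) - c j * (1 - 4 * c j ^ 2) := fun j hj => by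
    have h1 := h.c_mono j hj
    have b1 := abs_le.1 (h.c_le j)
    have b2 := abs_le.1 (h.c_le (j + 1))
    set q := c (j + 1) ^ 2 + c (j + 1) * c j + c j ^ 2 with hq
    have hq0 : 0 ≤ q := by
      nlinarith [sq_nonneg (c (j + 1) + c j), sq_nonneg (c (j + 1)), sq_nonneg (c j)]
    have hq1 : 4 * q ≤ 1 := by
      have := sq_le_sq' b1.1 b1.2
      have := sq_le_sq' b2.1 b2.2
      nlinarith [sq_nonneg (c (j + 1) - c j)]
    have e : c (j + 1) * (1 - 4 * c (j + 1) ^ 2) - c j * (1 - 4 * c j ^ 2)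
        = (c (j + 1) - c j) * (1 - 4 * q) := by rw [hq]; ring
    rw [e]
    have := mul_le_mul_of_nonneg_right h1 (by linarith : 0 ≤ 1 - 4 * q)
    nlinarith [mul_nonneg (h.mu_nonneg j) hq0]
  have t1 := telescopeLE_sq_average hs he
  have t2 := h.telescopeLE_error
  have t3 := telescopeLE_minmod_dissipation hs h0
  have t4 := telescopeLE_transport hs h0 h.p_le h.v_le h.mu_nonneg h.v_mono
  have t5 := telescopeLE_time_correction hs h0 h.c_le h.tau_nonneg h.c_sub
  have t6 := telescopeLE_cross hs h0 h.p_le hw h.mu_nonneg hwm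
  have t8 := telescopeLE_cubic_gain hs h0 h.p_le h.g_nonneg hκ1 h.g_mul_le
  have t9 : TelescopeLE (fun j => 1 / 8 * W ^ 2 * μ (j - 1)) (fun j => 1 / 8 * W ^ 2 * μ j) := by
    refine ⟨fun j => 1 / 8 * W ^ 2 * μ (j - 1),
      (summable_int_shift h.mu_summable (-1)).mul_left _, fun j => ?_⟩
    simp only [add_sub_cancel_right]
    apply le_of_eq; ring
  -- Budget: the surplus (r_j - r_{j-1})²/4 from `t2` costs 1/128 of the available 1/32 of `dissip`.
  -- The peak product has 1/4, of which `t8` takes 1/8. The cubic coefficient 3/16 - 1/25 exceeds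
  -- 1/500, and μ collects 1 + 3/40 + 1/4 ≤ 2. Terms with κ or κ² fit in what is left.
  obtain ⟨H, hH, hle⟩ := (((((((t1.add t2).add t3).add t4).add t5).add t6).add t8).add t9)
  refine ⟨H, hH, fun j => ?_⟩
  have := hle j
  have hG := sq_recon_sub_le p j
  have hG0 : 0 ≤ dissip p j := add_nonneg (sq_nonneg _) (sq_nonneg _)
  have hab : 0 ≤ rise p j * fall p (j + 1) := mul_nonneg (rise_nonneg _ _) (fall_nonneg _ _)
  have hκ2 : κ ^ 2 ≤ 1 / 4000 := by nlinarith
  have k1 : κ ^ 2 * dissip p j ≤ 1 / 4000 * dissip p j := mul_le_mul_of_nonneg_right hκ2 hG0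
  have k2 : κ * dissip p j ≤ 1 / 4000 * dissip p j := mul_le_mul_of_nonneg_right hκ1 hG0
  have k3 : κ ^ 2 * (rise p j * fall p (j + 1)) ≤ 1 / 4000 * (rise p j * fall p (j + 1)) :=
    mul_le_mul_of_nonneg_right hκ2 hab
  have k4 : κ * (rise p j * fall p (j + 1)) ≤ 1 / 4000 * (rise p j * fall p (j + 1)) :=
    mul_le_mul_of_nonneg_right hκ1 hab
  have k5 : 0 ≤ g * p j ^ 3 := mul_nonneg h.g_nonneg (pow_nonneg (h0 j) 3)
  have k6 : 0 ≤ W ^ 2 * μ j := mul_nonneg (sq_nonneg _) (h.mu_nonneg j)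
  linarith

end ConvexStep

/-! ### The flux -/

theorem derivWithin_Icc_self (g : ℝ → ℝ) (a x : ℝ) : derivWithin g (Icc a a) x = 0 := by
  exact derivWithin_zero_of_not_accPt fun h => Set.Infinite.of_accPt h (by simp)

/-- Some bound B is needed because `sSup` of an unbounded set is 0; its value plays no role. -/
theorem abs_le_rectNorm {K U : Set ℝ} {g : ℝ → ℝ → ℝ} {B : ℝ}
    (hB : ∀ k ∈ K, ∀ u ∈ U, |g k u| ≤ B) {k u : ℝ} (hk : k ∈ K) (hu : u ∈ U) :
    |g k u| ≤ rectNorm K U g := by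
  refine le_csSup ⟨B, ?_⟩ ⟨(k, u), ⟨hk, hu⟩, rfl⟩
  rintro _ ⟨⟨a, b⟩, ⟨ha, hb⟩, rfl⟩
  exact hB a ha b hb

theorem rectNorm_nonneg (K U : Set ℝ) (g : ℝ → ℝ → ℝ) : 0 ≤ rectNorm K U g := by
  refine Real.sSup_nonneg ?_
  rintro _ ⟨_, _, rfl⟩
  exact abs_nonneg _

theorem abs_affine_le {klo khi A B x y k : ℝ} (hk : k ∈ Icc klo khi) (hx : |x| ≤ A)
    (hy : |y| ≤ B) : |x + (k - klo) * y| ≤ A + (khi - klo) * B := by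
  have h1 : |k - klo| ≤ khi - klo := by
    rw [abs_of_nonneg (by linarith [hk.1])]; linarith [hk.2]
  calc |x + (k - klo) * y| ≤ |x| + |(k - klo) * y| := abs_add_le _ _
    _ ≤ A + (khi - klo) * B := by
      rw [abs_mul]
      exact add_le_add hx (mul_le_mul h1 hy (abs_nonneg _) ((abs_nonneg _).trans h1))

namespace IsConvexFlux

variable {klo khi ulo uhi γ₁ γ₂ : ℝ} {f : ℝ → ℝ → ℝ}

/-- On a one-point interval `derivWithin` is 0, which contradicts 0 < γ₁ ≤ f_uu. -/
theorem lo_lt_hi (hf : IsConvexFlux klo khi ulo uhi γ₁ γ₂ f) (hk : klo ≤ khi) (hu : ulo ≤ uhi) :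
    ulo < uhi := by
  rcases hu.eq_or_lt with h | h
  · subst h
    have h1 := hf.lower klo (left_mem_Icc.2 hk) ulo (left_mem_Icc.2 le_rfl)
    have h2 : partialU (Icc ulo ulo) (partialU (Icc ulo ulo) f) klo ulo = 0 :=
      derivWithin_Icc_self _ _ _
    linarith [hf.gamma_pos]
  · exact h

theorem partialK_eq (hf : IsConvexFlux klo khi ulo uhi γ₁ γ₂ f) {k u : ℝ}
    (hk : k ∈ Icc klo khi) (hu : u ∈ Icc ulo uhi) :
    partialK (Icc klo khi) f k u = partialK (Icc klo khi) f klo u := by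
  rcases (hk.1.trans hk.2).eq_or_lt with h | h
  · rw [le_antisymm (hk.2.trans h.symm.le) hk.1]
  have hd : ContDiffOn ℝ 1 (derivWithin (fun c => f c u) (Icc klo khi)) (Icc klo khi) :=
    (hf.contDiff_k u hu).derivWithin (uniqueDiffOn_Icc h) (by norm_num)
  exact constant_of_derivWithin_zero (hd.differentiableOn (by norm_num))
    (fun x hx => hf.kk_eq_zero u hu x ⟨hx.1, hx.2.le⟩) k hk

/-- Integrates f_kk = 0 twice. The flux is thereby described by two functions of u alone, so bounds
over the rectangle follow from compactness of the u-interval without any joint continuity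
hypothesis. -/
theorem eq_affine (hf : IsConvexFlux klo khi ulo uhi γ₁ γ₂ f) {k u : ℝ}
    (hk : k ∈ Icc klo khi) (hu : u ∈ Icc ulo uhi) :
    f k u = f klo u + (k - klo) * partialK (Icc klo khi) f klo u := by
  rcases (hk.1.trans hk.2).eq_or_lt with h | h
  · rw [le_antisymm (hk.2.trans h.symm.le) hk.1]; ring
  set B := partialK (Icc klo khi) f klo u with hB
  have hdf := (hf.contDiff_k u hu).differentiableOn (by norm_num)
  have hder : ∀ x ∈ Icc klo khi,
      HasDerivWithinAt (fun c => f c u - (c - klo) * B) 0 (Icc klo khi) x := by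
    intro x hx
    have h1 : HasDerivWithinAt (fun c => f c u) B (Icc klo khi) x := by
      have := (hdf x hx).hasDerivWithinAt
      rwa [show derivWithin (fun c => f c u) (Icc klo khi) x = B from hf.partialK_eq hx hu]
        at this
    have h2 := h1.sub (((hasDerivWithinAt_id x (Icc klo khi)).sub_const klo).mul_const B)
    exact h2.congr_deriv (by simp)
  have := constant_of_derivWithin_zero (f := fun c => f c u - (c - klo) * B)
    (fun x hx => (hder x hx).differentiableWithinAt)
    (fun x hx => (hder x ⟨hx.1, hx.2.le⟩).derivWithin
      (uniqueDiffOn_Icc h x ⟨hx.1, hx.2.le⟩)) k hk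
  linarith

/-- By affinity f_k is the difference quotient between the end points of the k-interval, so it
inherits the regularity of f in u. -/
theorem contDiffOn_partialK (hf : IsConvexFlux klo khi ulo uhi γ₁ γ₂ f) (hk : klo ≤ khi) :
    ContDiffOn ℝ 3 (fun u => partialK (Icc klo khi) f klo u) (Icc ulo uhi) := by
  rcases hk.eq_or_lt with h | h
  · subst h
    exact contDiffOn_const (c := (0 : ℝ)) |>.congr fun u _ => derivWithin_Icc_self _ _ _
  refine (((hf.contDiff_u khi (right_mem_Icc.2 hk)).sub
    (hf.contDiff_u klo (left_mem_Icc.2 hk))).mul (contDiffOn_const (c := (khi - klo)⁻¹))).congr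
    fun u hu => ?_
  have := hf.eq_affine (right_mem_Icc.2 hk) hu
  change _ = (f khi u - f klo u) * (khi - klo)⁻¹
  rw [this]
  field_simp [sub_ne_zero.2 h.ne']
  ring

theorem hasDerivWithinAt (hf : IsConvexFlux klo khi ulo uhi γ₁ γ₂ f) {k u : ℝ}
    (hk : k ∈ Icc klo khi) (hu : u ∈ Icc ulo uhi) :
    HasDerivWithinAt (f k) (partialU (Icc ulo uhi) f k u) (Icc ulo uhi) u :=
  ((hf.contDiff_u k hk).differentiableOn (by norm_num) u hu).hasDerivWithinAt

theorem contDiffOn_partialU (hf : IsConvexFlux klo khi ulo uhi γ₁ γ₂ f) (hu : ulo < uhi) {k : ℝ}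
    (hk : k ∈ Icc klo khi) : ContDiffOn ℝ 2 (partialU (Icc ulo uhi) f k) (Icc ulo uhi) :=
  (hf.contDiff_u k hk).derivWithin (uniqueDiffOn_Icc hu) (by norm_num)

theorem partialU_eq_affine (hf : IsConvexFlux klo khi ulo uhi γ₁ γ₂ f) (hu' : ulo < uhi)
    {k u : ℝ} (hk : k ∈ Icc klo khi) (hu : u ∈ Icc ulo uhi) :
    partialU (Icc ulo uhi) f k u = partialU (Icc ulo uhi) f klo u
      + (k - klo) * partialU (Icc ulo uhi) (partialK (Icc klo khi) f) klo u := by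
  have hkk := hk.1.trans hk.2
  have hB := ((hf.contDiffOn_partialK hkk).differentiableOn (by norm_num) u hu).hasDerivWithinAt
  have h := ((hf.hasDerivWithinAt (left_mem_Icc.2 hkk) hu).add (hB.const_mul (k - klo))).congr
    (fun v hv => hf.eq_affine hk hv) (hf.eq_affine hk hu)
  exact h.derivWithin (uniqueDiffOn_Icc hu' u hu)

theorem partialU_partialK_eq (hf : IsConvexFlux klo khi ulo uhi γ₁ γ₂ f)
    {k u : ℝ} (hk : k ∈ Icc klo khi) (hu : u ∈ Icc ulo uhi) :
    partialU (Icc ulo uhi) (partialK (Icc klo khi) f) k u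
      = partialU (Icc ulo uhi) (partialK (Icc klo khi) f) klo u :=
  derivWithin_congr (fun _ hv => hf.partialK_eq hk hv) (hf.partialK_eq hk hu)

theorem abs_partialU_le (hf : IsConvexFlux klo khi ulo uhi γ₁ γ₂ f) (hu' : ulo < uhi)
    {k u : ℝ} (hk : k ∈ Icc klo khi) (hu : u ∈ Icc ulo uhi) :
    |partialU (Icc ulo uhi) f k u|
      ≤ rectNorm (Icc klo khi) (Icc ulo uhi) (partialU (Icc ulo uhi) f) := by
  have hkk := hk.1.trans hk.2
  obtain ⟨A, hA⟩ := isCompact_Icc.exists_bound_of_continuousOn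
    (hf.contDiffOn_partialU hu' (left_mem_Icc.2 hkk)).continuousOn
  obtain ⟨B, hB⟩ := isCompact_Icc.exists_bound_of_continuousOn
    ((hf.contDiffOn_partialK hkk).derivWithin (m := 2) (uniqueDiffOn_Icc hu')
      (by norm_num)).continuousOn
  refine abs_le_rectNorm (B := A + (khi - klo) * B) (fun a ha b hb => ?_) hk hu
  rw [hf.partialU_eq_affine hu' ha hb]
  exact abs_affine_le ha (hA b hb) (hB b hb)

theorem abs_sub_le_partialK (hf : IsConvexFlux klo khi ulo uhi γ₁ γ₂ f)
    {k k' u : ℝ} (hk : k ∈ Icc klo khi) (hk' : k' ∈ Icc klo khi) (hu : u ∈ Icc ulo uhi) :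
    |f k' u - f k u|
      ≤ rectNorm (Icc klo khi) (Icc ulo uhi) (partialK (Icc klo khi) f) * |k' - k| := by
  have hkk := hk.1.trans hk.2
  obtain ⟨B, hB⟩ := isCompact_Icc.exists_bound_of_continuousOn
    (hf.contDiffOn_partialK hkk).continuousOn
  have h := abs_le_rectNorm (g := partialK (Icc klo khi) f) (B := B)
    (fun a ha b hb => by rw [hf.partialK_eq ha hb]; exact hB b hb) (left_mem_Icc.2 hkk) hu
  rw [hf.eq_affine hk hu, hf.eq_affine hk' hu]
  rw [show f klo u + (k' - klo) * partialK (Icc klo khi) f klo u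
    - (f klo u + (k - klo) * partialK (Icc klo khi) f klo u)
    = partialK (Icc klo khi) f klo u * (k' - k) by ring, abs_mul]
  exact mul_le_mul_of_nonneg_right h (abs_nonneg _)

theorem abs_partialU_sub_le (hf : IsConvexFlux klo khi ulo uhi γ₁ γ₂ f) (hu' : ulo < uhi)
    {k k' u : ℝ} (hk : k ∈ Icc klo khi) (hk' : k' ∈ Icc klo khi) (hu : u ∈ Icc ulo uhi) :
    |partialU (Icc ulo uhi) f k' u - partialU (Icc ulo uhi) f k u|
      ≤ rectNorm (Icc klo khi) (Icc ulo uhi)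
        (partialU (Icc ulo uhi) (partialK (Icc klo khi) f)) * |k' - k| := by
  have hkk := hk.1.trans hk.2
  obtain ⟨B, hB⟩ := isCompact_Icc.exists_bound_of_continuousOn
    ((hf.contDiffOn_partialK hkk).derivWithin (m := 2) (uniqueDiffOn_Icc hu')
      (by norm_num)).continuousOn
  have h := abs_le_rectNorm (g := partialU (Icc ulo uhi) (partialK (Icc klo khi) f)) (B := B)
    (fun a ha b hb => by rw [hf.partialU_partialK_eq ha hb]; exact hB b hb)
    (left_mem_Icc.2 hkk) hu
  rw [hf.partialU_eq_affine hu' hk hu, hf.partialU_eq_affine hu' hk' hu]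
  rw [show ∀ x y : ℝ, x + (k' - klo) * y - (x + (k - klo) * y) = y * (k' - k) by intros; ring,
    abs_mul]
  exact mul_le_mul_of_nonneg_right h (abs_nonneg _)

/-- The mean value theorem on a subinterval, for one-sided derivatives at the end points. -/
theorem _root_.exists_slope_of_hasDerivWithinAt {g g' : ℝ → ℝ} {a b x y : ℝ}
    (hg : ∀ t ∈ Icc a b, HasDerivWithinAt g (g' t) (Icc a b) t) (hx : x ∈ Icc a b)
    (hy : y ∈ Icc a b) (hxy : x < y) : ∃ t ∈ Ioo x y, g y - g x = g' t * (y - x) := by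
  have hsub : Icc x y ⊆ Icc a b := Icc_subset_Icc hx.1 hy.2
  obtain ⟨t, ht, he⟩ := exists_hasDerivAt_eq_slope g g' hxy
    (fun t ht => ((hg t (hsub ht)).continuousWithinAt).mono hsub)
    (fun t ht => (hg t (hsub (Ioo_subset_Icc_self ht))).hasDerivAt
      (Icc_mem_nhds (hx.1.trans_lt ht.1) (ht.2.trans_le hy.2)))
  refine ⟨t, ht, ?_⟩
  rw [he]
  field_simp [(sub_pos.2 hxy).ne']

theorem partialU_sub (hf : IsConvexFlux klo khi ulo uhi γ₁ γ₂ f) (hu' : ulo < uhi)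
    {k x y : ℝ} (hk : k ∈ Icc klo khi) (hx : x ∈ Icc ulo uhi) (hy : y ∈ Icc ulo uhi)
    (hxy : x ≤ y) :
    γ₁ * (y - x) ≤ partialU (Icc ulo uhi) f k y - partialU (Icc ulo uhi) f k x ∧
      partialU (Icc ulo uhi) f k y - partialU (Icc ulo uhi) f k x ≤ γ₂ * (y - x) := by
  rcases hxy.eq_or_lt with h | h
  · subst h; simp
  obtain ⟨t, ht, he⟩ := exists_slope_of_hasDerivWithinAt
    (g := partialU (Icc ulo uhi) f k)
    (g' := partialU (Icc ulo uhi) (partialU (Icc ulo uhi) f) k)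
    (fun t ht => ((hf.contDiffOn_partialU hu' hk).differentiableOn
      (by norm_num) t ht).hasDerivWithinAt) hx hy h
  have htU : t ∈ Icc ulo uhi := ⟨hx.1.trans ht.1.le, ht.2.le.trans hy.2⟩
  rw [he]
  exact ⟨mul_le_mul_of_nonneg_right (hf.lower k hk t htU) (by linarith),
    mul_le_mul_of_nonneg_right (hf.upper k hk t htU) (by linarith)⟩

theorem abs_partialU_sub_le_min (hf : IsConvexFlux klo khi ulo uhi γ₁ γ₂ f) (hu' : ulo < uhi)
    {k x y : ℝ} (hk : k ∈ Icc klo khi) (hx : x ∈ Icc ulo uhi) (hy : y ∈ Icc ulo uhi) :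
    |partialU (Icc ulo uhi) f k y - partialU (Icc ulo uhi) f k x|
      ≤ min (2 * rectNorm (Icc klo khi) (Icc ulo uhi) (partialU (Icc ulo uhi) f))
        (γ₂ * |y - x|) := by
  refine le_min ?_ ?_
  · have h1 := hf.abs_partialU_le hu' hk hx
    have h2 := hf.abs_partialU_le hu' hk hy
    rw [abs_le] at *
    constructor <;> linarith [h1.1, h1.2, h2.1, h2.2]
  · have hγ := hf.gamma_pos
    rcases le_total x y with h | h
    · have h1 := hf.partialU_sub hu' hk hx hy h
      have : 0 ≤ γ₁ * (y - x) := mul_nonneg hγ.le (by linarith)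
      rw [abs_of_nonneg (by linarith), abs_of_nonneg (by linarith)]
      exact h1.2
    · have h1 := hf.partialU_sub hu' hk hy hx h
      have : 0 ≤ γ₁ * (x - y) := mul_nonneg hγ.le (by linarith)
      rw [abs_sub_comm, abs_of_nonneg (by linarith), abs_sub_comm, abs_of_nonneg (by linarith)]
      exact h1.2

theorem exists_slope (hf : IsConvexFlux klo khi ulo uhi γ₁ γ₂ f)
    {k x y : ℝ} (hk : k ∈ Icc klo khi) (hx : x ∈ Icc ulo uhi) (hy : y ∈ Icc ulo uhi)
    (hxy : x < y) :
    ∃ t ∈ Ioo x y, f k y - f k x = partialU (Icc ulo uhi) f k t * (y - x) :=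
  exists_slope_of_hasDerivWithinAt (fun _ ht => hf.hasDerivWithinAt hk ht) hx hy hxy

theorem abs_sub_le (hf : IsConvexFlux klo khi ulo uhi γ₁ γ₂ f) (hu' : ulo < uhi)
    {k x y : ℝ} (hk : k ∈ Icc klo khi) (hx : x ∈ Icc ulo uhi) (hy : y ∈ Icc ulo uhi) :
    |f k y - f k x|
      ≤ rectNorm (Icc klo khi) (Icc ulo uhi) (partialU (Icc ulo uhi) f) * |y - x| := by
  wlog hxy : x < y generalizing x y
  · rcases (not_lt.1 hxy).eq_or_lt with h | h
    · subst h; simp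
    · rw [abs_sub_comm, abs_sub_comm y]; exact this hy hx h
  obtain ⟨t, ht, he⟩ := hf.exists_slope hk hx hy hxy
  rw [he, abs_mul]
  exact mul_le_mul_of_nonneg_right
    (hf.abs_partialU_le hu' hk ⟨hx.1.trans ht.1.le, ht.2.le.trans hy.2⟩) (abs_nonneg _)

/-- The remainder of the first-order Taylor expansion of the flux. -/
theorem abs_taylor_le (hf : IsConvexFlux klo khi ulo uhi γ₁ γ₂ f) (hu' : ulo < uhi)
    {k x y : ℝ} (hk : k ∈ Icc klo khi) (hx : x ∈ Icc ulo uhi) (hy : y ∈ Icc ulo uhi) :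
    |f k y - f k x - partialU (Icc ulo uhi) f k x * (y - x)|
      ≤ min (2 * rectNorm (Icc klo khi) (Icc ulo uhi) (partialU (Icc ulo uhi) f))
        (γ₂ * |y - x|) * |y - x| := by
  obtain ⟨t, htU, ht, he⟩ : ∃ t ∈ Icc ulo uhi, |t - x| ≤ |y - x| ∧
      f k y - f k x = partialU (Icc ulo uhi) f k t * (y - x) := by
    rcases lt_trichotomy x y with h | h | h
    · obtain ⟨t, ht, he⟩ := hf.exists_slope hk hx hy h
      refine ⟨t, ⟨hx.1.trans ht.1.le, ht.2.le.trans hy.2⟩, ?_, he⟩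
      rw [abs_of_pos (sub_pos.2 ht.1), abs_of_pos (sub_pos.2 h)]; linarith [ht.2]
    · exact ⟨x, hx, by simp, by subst h; simp⟩
    · obtain ⟨t, ht, he⟩ := hf.exists_slope hk hy hx h
      refine ⟨t, ⟨hy.1.trans ht.1.le, ht.2.le.trans hx.2⟩, ?_, by linarith⟩
      rw [abs_of_neg (sub_neg.2 ht.2), abs_of_neg (sub_neg.2 h)]; linarith [ht.1]
  have hγ₂ : 0 ≤ γ₂ := hf.gamma_pos.le.trans ((hf.lower k hk x hx).trans (hf.upper k hk x hx))
  rw [he, ← sub_mul, abs_mul]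
  refine mul_le_mul_of_nonneg_right ((hf.abs_partialU_sub_le_min hu' hk hx htU).trans ?_)
    (abs_nonneg _)
  exact min_le_min_left _ (mul_le_mul_of_nonneg_left ht hγ₂)

/-- The quadratic lower bounds of strong convexity at both end points of an interval. -/
theorem strong_convexity (hf : IsConvexFlux klo khi ulo uhi γ₁ γ₂ f) (hu' : ulo < uhi)
    {k x y : ℝ} (hk : k ∈ Icc klo khi) (hx : x ∈ Icc ulo uhi) (hy : y ∈ Icc ulo uhi)
    (hxy : x < y) :
    (partialU (Icc ulo uhi) f k x + γ₁ / 2 * (y - x)) * (y - x) ≤ f k y - f k x ∧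
      f k y - f k x ≤ (partialU (Icc ulo uhi) f k y - γ₁ / 2 * (y - x)) * (y - x) := by
  obtain ⟨t, ht, he⟩ := exists_slope_of_hasDerivWithinAt
    (g := fun v => f k v - γ₁ / 2 * v ^ 2)
    (g' := fun v => partialU (Icc ulo uhi) f k v - γ₁ * v)
    (fun v hv => by
      have h2 := (((hasDerivWithinAt_id v (Icc ulo uhi)).pow 2).const_mul (γ₁ / 2))
      refine ((hf.hasDerivWithinAt hk hv).sub h2).congr_deriv ?_
      simp; ring) hx hy hxy
  have htU : t ∈ Icc ulo uhi := ⟨hx.1.trans ht.1.le, ht.2.le.trans hy.2⟩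
  have h1 := (hf.partialU_sub hu' hk hx htU ht.1.le).1
  have h2 := (hf.partialU_sub hu' hk htU hy ht.2.le).1
  have hpos : 0 ≤ y - x := by linarith
  have h3 := mul_le_mul_of_nonneg_right h1 hpos
  have h4 := mul_le_mul_of_nonneg_right h2 hpos
  constructor <;> nlinarith

end IsConvexFlux

/-! ### The coefficient -/

theorem intervalIntegrable_of_memLp_top {k : ℝ → ℝ} (hk : MemLp k ∞ volume) (a b : ℝ) :
    IntervalIntegrable k volume a b := by
  rw [intervalIntegrable_iff]
  have : IsFiniteMeasure (volume.restrict (uIoc a b)) :=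
    isFiniteMeasure_restrict.2 (by rw [uIoc]; exact measure_Ioc_lt_top.ne)
  have h : MemLp k ∞ (volume.restrict (uIoc a b)) := hk.restrict _
  exact h.integrable le_top

theorem cellAverage_bounds {k : ℝ → ℝ} (hk : MemLp k ∞ volume) {a b : ℝ}
    (hab : ∀ᵐ x ∂(volume : Measure ℝ), k x ∈ Icc a b) {dx : ℝ} (hdx : 0 < dx) (x₀ : ℝ) (j : ℤ) :
    cellAverage dx x₀ k j ∈ Icc a b := by
  unfold cellAverage
  set l := x₀ + ((j : ℝ) - 1 / 2) * dx with hl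
  set r := x₀ + ((j : ℝ) + 1 / 2) * dx with hr
  have hlr : r - l = dx := by rw [hl, hr]; ring
  have hle : l ≤ r := by linarith
  have hi := intervalIntegrable_of_memLp_top hk l r
  have h1 : ∫ _ in l..r, a ≤ ∫ x in l..r, k x :=
    intervalIntegral.integral_mono_ae hle (by simp) hi (hab.mono fun x hx => hx.1)
  have h2 : ∫ x in l..r, k x ≤ ∫ _ in l..r, b :=
    intervalIntegral.integral_mono_ae hle hi (by simp) (hab.mono fun x hx => hx.2)
  rw [intervalIntegral.integral_const, hlr, smul_eq_mul] at h1 h2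
  rw [one_div, inv_mul_eq_div]
  exact ⟨by rw [le_div_iff₀ hdx]; linarith, by rw [div_le_iff₀ hdx]; linarith⟩

theorem abs_cellAverage_le {k : ℝ → ℝ} (hk : MemLp k ∞ volume) {dx : ℝ} (hdx : 0 < dx) (x₀ : ℝ)
    (j : ℤ) : |cellAverage dx x₀ k j| ≤ supNorm k := by
  rw [abs_le]
  refine cellAverage_bounds hk ?_ hdx x₀ j
  have h := ae_le_eLpNormEssSup (f := k) (μ := volume)
  have hfin : eLpNorm k ∞ volume ≠ ∞ := hk.2.ne
  filter_upwards [h] with x hx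
  rw [← eLpNorm_exponent_top] at hx
  have := ENNReal.toReal_mono hfin hx
  rw [toReal_enorm, Real.norm_eq_abs] at this
  exact abs_le.1 this

theorem cellAverage_congr {k g : ℝ → ℝ} (h : g =ᵐ[volume] k) (dx x₀ : ℝ) (j : ℤ) :
    cellAverage dx x₀ g j = cellAverage dx x₀ k j := by
  unfold cellAverage
  rw [intervalIntegral.integral_congr_ae (h.mono fun x hx _ => hx)]

/-- With all averages taken over one reference cell, increments can be summed pointwise in y, along
the points y + j dx, before integrating. -/
theorem cellAverage_eq_shift (g : ℝ → ℝ) (dx x₀ : ℝ) (j : ℤ) :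
    cellAverage dx x₀ g j
      = 1 / dx * ∫ y in (x₀ - dx / 2)..(x₀ + dx / 2), g (y + j * dx) := by
  unfold cellAverage
  rw [intervalIntegral.integral_comp_add_right (fun y => g y)]
  congr 2 <;> ring

theorem sum_abs_sub_le_eVariationOn {g : ℝ → ℝ} (hg : eVariationOn g univ ≠ ∞) {dx : ℝ}
    (hdx : 0 < dx) (y : ℝ) (s : Finset ℤ) :
    ∑ j ∈ s, |g (y + ((j + 1 : ℤ) : ℝ) * dx) - g (y + (j : ℝ) * dx)|
      ≤ (eVariationOn g univ).toReal := by
  set F : ℤ → ℝ := fun j => |g (y + ((j + 1 : ℤ) : ℝ) * dx) - g (y + (j : ℝ) * dx)| with hF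
  obtain ⟨n, hn⟩ : ∃ n : ℕ, ∀ j ∈ s, -(n : ℤ) ≤ j ∧ j < n := by
    refine ⟨∑ j ∈ s, (j.natAbs + 1), fun j hj => ?_⟩
    have := Finset.single_le_sum (f := fun j : ℤ => j.natAbs + 1) (fun _ _ => Nat.zero_le _) hj
    omega
  have hsub : s ⊆ (Finset.range (2 * n)).image (fun i : ℕ => (i : ℤ) - n) := by
    intro j hj
    obtain ⟨h1, h2⟩ := hn j hj
    exact Finset.mem_image.2 ⟨(j + n).toNat, by rw [Finset.mem_range]; omega, by omega⟩
  have hmono : Monotone fun i : ℕ => y + (((i : ℤ) - n : ℤ) : ℝ) * dx := by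
    intro a b hab
    have : (((a : ℤ) - n : ℤ) : ℝ) ≤ (((b : ℤ) - n : ℤ) : ℝ) := by
      exact_mod_cast (by omega : (a : ℤ) - n ≤ (b : ℤ) - n)
    have := mul_le_mul_of_nonneg_right this hdx.le
    simp only
    linarith
  have hvar := eVariationOn.sum_le (f := g) (s := univ) (n := 2 * n) hmono (fun _ => mem_univ _)
  have hterm : ∀ i : ℕ, edist (g (y + ((((i + 1 : ℕ) : ℤ) - n : ℤ) : ℝ) * dx))
      (g (y + (((i : ℤ) - n : ℤ) : ℝ) * dx)) = ENNReal.ofReal (F ((i : ℤ) - n)) := by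
    intro i
    rw [edist_dist, Real.dist_eq, hF]
    simp only
    rw [show (((i + 1 : ℕ) : ℤ) - n : ℤ) = ((i : ℤ) - n) + 1 by push_cast; ring]
  have hF0 : ∀ j, 0 ≤ F j := fun j => abs_nonneg _
  calc ∑ j ∈ s, F j ≤ ∑ j ∈ (Finset.range (2 * n)).image (fun i : ℕ => (i : ℤ) - n), F j :=
        Finset.sum_le_sum_of_subset_of_nonneg hsub fun j _ _ => hF0 j
    _ = ∑ i ∈ Finset.range (2 * n), F ((i : ℤ) - n) :=
        Finset.sum_image fun a _ b _ h => by
          have : (a : ℤ) - n = (b : ℤ) - n := h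
          omega
    _ = (ENNReal.ofReal (∑ i ∈ Finset.range (2 * n), F ((i : ℤ) - n))).toReal :=
        (ENNReal.toReal_ofReal (Finset.sum_nonneg fun i _ => hF0 _)).symm
    _ ≤ (eVariationOn g univ).toReal := by
        refine ENNReal.toReal_mono hg ?_
        rw [ENNReal.ofReal_sum_of_nonneg fun i _ => hF0 _]
        refine le_trans (le_of_eq ?_) hvar
        exact Finset.sum_congr rfl fun i _ => (hterm i).symm

theorem sum_abs_cellAverage_sub_le {k g : ℝ → ℝ} (hk : MemLp k ∞ volume) (hgk : g =ᵐ[volume] k)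
    (hg : eVariationOn g univ ≠ ∞) {dx : ℝ} (hdx : 0 < dx) (x₀ : ℝ) (s : Finset ℤ) :
    ∑ j ∈ s, |cellAverage dx x₀ k (j + 1) - cellAverage dx x₀ k j|
      ≤ (eVariationOn g univ).toReal := by
  have hgL : MemLp g ∞ volume := hk.ae_eq hgk.symm
  set l := x₀ - dx / 2 with hl
  set r := x₀ + dx / 2 with hr
  have hlr : r - l = dx := by rw [hl, hr]; ring
  have hle : l ≤ r := by linarith
  have hint : ∀ j : ℤ, IntervalIntegrable (fun y => g (y + (j : ℝ) * dx)) volume l r := by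
    intro j
    have := (intervalIntegrable_of_memLp_top hgL (l + j * dx) (r + j * dx)).comp_add_right (j * dx)
    simpa using this
  have hterm : ∀ j ∈ s, |cellAverage dx x₀ k (j + 1) - cellAverage dx x₀ k j|
      ≤ 1 / dx * ∫ y in l..r, |g (y + ((j + 1 : ℤ) : ℝ) * dx) - g (y + (j : ℝ) * dx)| := by
    intro j _
    rw [← cellAverage_congr hgk, ← cellAverage_congr hgk, cellAverage_eq_shift,
      cellAverage_eq_shift, ← mul_sub, ← intervalIntegral.integral_sub (hint (j + 1)) (hint j),
      abs_mul, abs_of_pos (by positivity : 0 < 1 / dx)]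
    exact mul_le_mul_of_nonneg_left (intervalIntegral.abs_integral_le_integral_abs hle)
      (by positivity)
  have habs : ∀ j ∈ s, IntervalIntegrable
      (fun y => |g (y + ((j + 1 : ℤ) : ℝ) * dx) - g (y + (j : ℝ) * dx)|) volume l r :=
    fun j _ => ((hint (j + 1)).sub (hint j)).abs
  refine (Finset.sum_le_sum hterm).trans ?_
  rw [← Finset.mul_sum, ← intervalIntegral.integral_finsetSum habs]
  have h1 : ∫ y in l..r, ∑ j ∈ s, |g (y + ((j + 1 : ℤ) : ℝ) * dx) - g (y + (j : ℝ) * dx)|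
      ≤ ∫ _ in l..r, (eVariationOn g univ).toReal := by
    refine intervalIntegral.integral_mono hle ?_ (by simp)
      fun y => sum_abs_sub_le_eVariationOn hg hdx y s
    have := IntervalIntegrable.sum s habs
    exact this.congr (fun y _ => by simp [Finset.sum_apply])
  rw [intervalIntegral.integral_const, hlr, smul_eq_mul] at h1
  rw [one_div, inv_mul_le_iff₀ hdx]
  exact h1

theorem IsCoefficient.sum_abs_sub_le {klo khi : ℝ} {k : ℝ → ℝ} (hk : IsCoefficient klo khi k)
    {dx : ℝ} (hdx : 0 < dx) (x₀ : ℝ) (s : Finset ℤ) :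
    ∑ j ∈ s, |cellAverage dx x₀ k (j + 1) - cellAverage dx x₀ k j| ≤ bvNorm k := by
  have h0 : 0 ≤ ∑ j ∈ s, |cellAverage dx x₀ k (j + 1) - cellAverage dx x₀ k j| :=
    Finset.sum_nonneg fun _ _ => abs_nonneg _
  rw [bvNorm, ← ENNReal.ofReal_le_iff_le_toReal hk.finite_var]
  -- Cell averages do not see the choice of representative, so the bound is proved for each one;
  -- infinite variation is trivial.
  refine le_iInf₂ fun g hg => ?_
  by_cases hv : eVariationOn g univ = ∞
  · rw [hv]; exact le_top
  · rw [ENNReal.ofReal_le_iff_le_toReal hv]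
    exact sum_abs_cellAverage_sub_le hk.memLp hg hv hdx x₀ s

theorem IsCoefficient.summable_abs_sub {klo khi : ℝ} {k : ℝ → ℝ} (hk : IsCoefficient klo khi k)
    {dx : ℝ} (hdx : 0 < dx) (x₀ : ℝ) :
    Summable fun j : ℤ => |cellAverage dx x₀ k (j + 1) - cellAverage dx x₀ k j| :=
  summable_of_sum_le (fun _ => abs_nonneg _) fun s => hk.sum_abs_sub_le hdx x₀ s

theorem IsCoefficient.tsum_abs_sub_le {klo khi : ℝ} {k : ℝ → ℝ} (hk : IsCoefficient klo khi k)
    {dx : ℝ} (hdx : 0 < dx) (x₀ : ℝ) :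
    ∑' j : ℤ, |cellAverage dx x₀ k (j + 1) - cellAverage dx x₀ k j| ≤ bvNorm k :=
  Real.tsum_le_of_sum_le (fun _ => abs_nonneg _) fun s => hk.sum_abs_sub_le hdx x₀ s

/-! ### Minmod slopes -/

/-- The positive jumps of a sequence. -/
def posJump (u : ℤ → ℝ) (j : ℤ) : ℝ := max (u (j + 1) - u j) 0

theorem posJump_nonneg (u : ℤ → ℝ) (j : ℤ) : 0 ≤ posJump u j := le_max_right _ _

/-- The average lies between the outer arguments, so it never decides the minimum and the limiter is
the two-argument minmod. -/
theorem minmod_average (a b : ℝ) :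
    minmod a (1 / 2 * (a + b)) b
      = if 0 < a ∧ 0 < b then min a b else if a < 0 ∧ b < 0 then max a b else 0 := by
  unfold minmod
  rcases lt_trichotomy a 0 with ha | ha | ha <;> rcases lt_trichotomy b 0 with hb | hb | hb
  · have hc : 1 / 2 * (a + b) < 0 := by linarith
    rw [Real.sign_of_neg ha, Real.sign_of_neg hb, Real.sign_of_neg hc, abs_of_neg ha,
      abs_of_neg hb, abs_of_neg hc]
    simp only [and_self, if_true]
    rw [if_neg (by rintro ⟨h, -⟩; linarith), if_pos ⟨ha, hb⟩]
    rcases le_total a b with h | h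
    · rw [min_eq_right (by linarith : -b ≤ -(1 / 2 * (a + b))), min_eq_right (by linarith),
        max_eq_right h]; ring
    · rw [min_eq_left (by linarith : -(1 / 2 * (a + b)) ≤ -b), min_eq_left (by linarith),
        max_eq_left h]; ring
  · subst hb; simp [Real.sign_of_neg ha, ha.not_gt]
  · simp [Real.sign_of_neg ha, Real.sign_of_pos hb, ha.not_gt, hb.not_gt]
    intro h1 h2; rw [h2] at h1; norm_num at h1
  · subst ha; simp
  · subst ha; simp
  · subst ha; simp
  · simp [Real.sign_of_pos ha, Real.sign_of_neg hb, ha.not_gt, hb.not_gt]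
    intro h1 h2; rw [h2] at h1; norm_num at h1
  · subst hb; simp [Real.sign_of_pos ha, ha.not_gt]
  · have hc : 0 < 1 / 2 * (a + b) := by linarith
    rw [Real.sign_of_pos ha, Real.sign_of_pos hb, Real.sign_of_pos hc, abs_of_pos ha,
      abs_of_pos hb, abs_of_pos hc]
    simp only [and_self, if_true]
    rw [if_pos ⟨ha, hb⟩]
    rcases le_total a b with h | h
    · rw [min_eq_left (by linarith : 1 / 2 * (a + b) ≤ b), min_eq_left (by linarith),
        min_eq_left h]; ring
    · rw [min_eq_right (by linarith : b ≤ 1 / 2 * (a + b)), min_eq_right h]; ring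

theorem mmSlope_eq (u : ℤ → ℝ) (j : ℤ) :
    mmSlope u j = if 0 < u (j + 1) - u j ∧ 0 < u j - u (j - 1)
      then min (u (j + 1) - u j) (u j - u (j - 1))
      else if u (j + 1) - u j < 0 ∧ u j - u (j - 1) < 0
      then max (u (j + 1) - u j) (u j - u (j - 1)) else 0 := by
  rw [← minmod_average]
  unfold mmSlope
  congr 2
  ring

theorem mmSlope_bounds (u : ℤ → ℝ) (j : ℤ) :
    (min (u (j + 1) - u j) 0 ≤ mmSlope u j ∧ mmSlope u j ≤ max (u (j + 1) - u j) 0) ∧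
      (min (u j - u (j - 1)) 0 ≤ mmSlope u j ∧ mmSlope u j ≤ max (u j - u (j - 1)) 0) := by
  rw [mmSlope_eq]
  split_ifs with h1 h2
  · have : 0 < min (u (j + 1) - u j) (u j - u (j - 1)) := lt_min h1.1 h1.2
    exact ⟨⟨(min_le_right _ _).trans this.le, (min_le_left _ _).trans (le_max_left _ _)⟩,
      ⟨(min_le_right _ _).trans this.le, (min_le_right _ _).trans (le_max_left _ _)⟩⟩
  · have : max (u (j + 1) - u j) (u j - u (j - 1)) < 0 := max_lt h2.1 h2.2
    exact ⟨⟨(min_le_left _ _).trans (le_max_left _ _), this.le.trans (le_max_right _ _)⟩,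
      ⟨(min_le_left _ _).trans (le_max_right _ _), this.le.trans (le_max_right _ _)⟩⟩
  · exact ⟨⟨min_le_right _ _, le_max_right _ _⟩, ⟨min_le_right _ _, le_max_right _ _⟩⟩

/-- Next to a positive jump the slope depends on positive parts alone: a nonpositive neighbouring
jump gives slope 0, which is also the minimum with `posJump` = 0. -/
theorem mmSlope_left {u : ℤ → ℝ} {j : ℤ} (h : 0 < u (j + 1) - u j) :
    mmSlope u j = min (posJump u (j - 1)) (posJump u j) := by
  unfold posJump
  rw [mmSlope_eq, sub_add_cancel, max_eq_left h.le]
  by_cases h' : 0 < u j - u (j - 1)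
  · rw [if_pos ⟨h, h'⟩, max_eq_left h'.le, min_comm]
  · rw [if_neg (fun hh => h' hh.2), if_neg (fun hh => hh.1.not_gt h),
      max_eq_right (not_lt.1 h'), min_eq_left h.le]

theorem mmSlope_right {u : ℤ → ℝ} {j : ℤ} (h : 0 < u (j + 1) - u j) :
    mmSlope u (j + 1) = min (posJump u j) (posJump u (j + 1)) := by
  unfold posJump
  rw [mmSlope_eq, add_sub_cancel_right, max_eq_left h.le]
  by_cases h' : 0 < u (j + 1 + 1) - u (j + 1)
  · rw [if_pos ⟨h', h⟩, max_eq_left h'.le, min_comm]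
  · rw [if_neg (fun hh => h' hh.1), if_neg (fun hh => hh.2.not_gt h),
      max_eq_right (not_lt.1 h'), min_eq_right h.le]

theorem recon_eq_min (p : ℤ → ℝ) (j : ℤ) :
    recon p j = 1 / 8 * (min (p j) (p (j + 1)) - min (p (j - 1)) (p j)) := by
  unfold recon rise fall
  rw [add_sub_cancel_right]
  rcases le_total (p (j - 1)) (p j) with h1 | h1 <;>
    rcases le_total (p j) (p (j + 1)) with h2 | h2 <;>
    simp only [h1, h2, min_eq_left, min_eq_right, max_eq_left, max_eq_right, sub_nonneg,
      sub_nonpos] <;> ring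

theorem recon_posJump {u : ℤ → ℝ} {j : ℤ} (h : 0 < u (j + 1) - u j) :
    recon (posJump u) j = 1 / 8 * (mmSlope u (j + 1) - mmSlope u j) := by
  rw [recon_eq_min, mmSlope_left h, mmSlope_right h]

theorem abs_mmSlope_le (u : ℤ → ℝ) (j : ℤ) :
    |mmSlope u j| ≤ |u (j + 1) - u j| ∧ |mmSlope u j| ≤ |u j - u (j - 1)| := by
  have aux : ∀ x s : ℝ, min x 0 ≤ s → s ≤ max x 0 → |s| ≤ |x| := by
    intro x s h1 h2
    rcases le_total 0 x with h | h
    · rw [min_eq_right h] at h1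
      rw [max_eq_left h] at h2
      rwa [abs_of_nonneg h, abs_of_nonneg h1]
    · rw [min_eq_left h] at h1
      rw [max_eq_right h] at h2
      rw [abs_of_nonpos h, abs_of_nonpos h2]; linarith
  obtain ⟨⟨h1, h2⟩, h3, h4⟩ := mmSlope_bounds u j
  exact ⟨aux _ _ h1 h2, aux _ _ h3 h4⟩

/-- Being limited by both adjacent jumps, the slope exceeds neither distance from u_j to the ends of
the interval. This keeps mid-time values in the domain of f. -/
theorem add_mul_mmSlope_mem {u : ℤ → ℝ} {a b : ℝ} (hu : ∀ j, u j ∈ Icc a b) (j : ℤ) {t : ℝ}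
    (ht : |t| ≤ 1) : u j + t * mmSlope u j ∈ Icc a b := by
  obtain ⟨⟨h1, h2⟩, h3, h4⟩ := mmSlope_bounds u j
  have ha := hu (j - 1)
  have hb := hu j
  have hc := hu (j + 1)
  have ht' : |t * mmSlope u j| ≤ |mmSlope u j| := by
    rw [abs_mul]; exact mul_le_of_le_one_left (abs_nonneg _) ht
  have hs : |mmSlope u j| ≤ b - u j ∧ |mmSlope u j| ≤ u j - a := by
    rcases le_total 0 (mmSlope u j) with h | h
    · rw [abs_of_nonneg h]
      constructor
      · exact h2.trans (max_le (by linarith [hc.2]) (by linarith [hb.2]))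
      · exact h4.trans (max_le (by linarith [ha.1]) (by linarith [hb.1]))
    · rw [abs_of_nonpos h]
      constructor
      · have := (le_min (by linarith [ha.2] : u j - b ≤ u j - u (j - 1))
          (by linarith [hb.2])).trans h3
        linarith
      · have := (le_min (by linarith [hc.1] : a - u j ≤ u (j + 1) - u j)
          (by linarith [hb.1])).trans h1
        linarith
  obtain ⟨h5, h6⟩ := abs_le.1 ht'
  exact ⟨by linarith [hs.2], by linarith [hs.1]⟩

theorem posJump_add_le {u : ℤ → ℝ} {a b : ℝ} (hu : ∀ j, u j ∈ Icc a b) (j : ℤ) :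
    posJump u (j - 1) + posJump u j ≤ b - a := by
  have ha := hu (j - 1)
  have hb := hu j
  have hc := hu (j + 1)
  unfold posJump
  rw [sub_add_cancel]
  rcases max_choice (u j - u (j - 1)) 0 with h | h <;>
    rcases max_choice (u (j + 1) - u j) 0 with h' | h' <;> rw [h, h'] <;>
    linarith [ha.1, ha.2, hb.1, hb.2, hc.1, hc.2]

/-! ### The scheme -/

/-- The setting of one step of the scheme under the CFL condition. -/
structure SchemeStep (klo khi ulo uhi γ₁ γ₂ lam κ : ℝ) (f : ℝ → ℝ → ℝ) (kd u : ℤ → ℝ) : Prop where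
  flux : IsConvexFlux klo khi ulo uhi γ₁ γ₂ f
  lo_lt_hi : ulo < uhi
  lam_pos : 0 < lam
  kd_mem : ∀ j, kd j ∈ Icc klo khi
  u_mem : ∀ j, u j ∈ Icc ulo uhi
  cfl : lam * rectNorm (Icc klo khi) (Icc ulo uhi) (partialU (Icc ulo uhi) f) ≤ κ
  kappa_le : κ ≤ 1 / 4000
  kappa_le' : κ ≤ γ₁ / (7500 * γ₂)

/-- The normalized speed in a cell. -/
def cellSpeed (lam : ℝ) (U : Set ℝ) (f : ℝ → ℝ → ℝ) (kd u : ℤ → ℝ) (j : ℤ) : ℝ :=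
  lam * partialU U f (kd j) (u j)

/-- The normalized mean speed over a positive jump. -/
def jumpSpeed (lam : ℝ) (f : ℝ → ℝ → ℝ) (kd u : ℤ → ℝ) (j : ℤ) : ℝ :=
  if 0 < posJump u j then lam * ((f (kd j) (u (j + 1)) - f (kd j) (u j)) / posJump u j) else 0

/-- The normalized increment of the mid-time flux over a jump, for the coefficient on the left. -/
def midFlux (lam : ℝ) (U : Set ℝ) (f : ℝ → ℝ → ℝ) (kd u : ℤ → ℝ) (j : ℤ) : ℝ :=
  lam * (f (kd j) (midValue lam U f kd u (j + 1)) - f (kd j) (midValue lam U f kd u j))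

/-- The increments of `midFlux` over the positive jumps. -/
def jumpFlux (lam : ℝ) (U : Set ℝ) (f : ℝ → ℝ → ℝ) (kd u : ℤ → ℝ) (j : ℤ) : ℝ :=
  if 0 < posJump u j then midFlux lam U f kd u j else 0

/-- The variation of the coefficient over a jump, with a weight. -/
def coefVar (B : ℝ) (kd : ℤ → ℝ) (j : ℤ) : ℝ := B * |kd (j + 1) - kd j|

/-- A bound for the variation of the speed over a positive jump. -/
def speedVar (κ Λ : ℝ) (p μ : ℤ → ℝ) (j : ℤ) : ℝ := min (2 * κ) (Λ * p j) + min (2 * κ) (μ j)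

theorem coefVar_nonneg {B : ℝ} (hB : 0 ≤ B) (kd : ℤ → ℝ) (j : ℤ) : 0 ≤ coefVar B kd j :=
  mul_nonneg hB (abs_nonneg _)

theorem posJump_eq {u : ℤ → ℝ} {j : ℤ} (h : 0 < posJump u j) : posJump u j = u (j + 1) - u j := by
  unfold posJump at *
  rcases max_choice (u (j + 1) - u j) 0 with h' | h'
  · exact h'
  · rw [h'] at h; exact absurd h (lt_irrefl _)

namespace SchemeStep

variable {klo khi ulo uhi γ₁ γ₂ lam κ : ℝ} {f : ℝ → ℝ → ℝ} {kd u : ℤ → ℝ}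

theorem gamma₂_pos (h : SchemeStep klo khi ulo uhi γ₁ γ₂ lam κ f kd u) : 0 < γ₂ :=
  h.flux.gamma_pos.trans_le
    ((h.flux.lower _ (h.kd_mem 0) _ (h.u_mem 0)).trans (h.flux.upper _ (h.kd_mem 0) _ (h.u_mem 0)))

theorem kappa_nonneg (h : SchemeStep klo khi ulo uhi γ₁ γ₂ lam κ f kd u) : 0 ≤ κ :=
  (mul_nonneg h.lam_pos.le (rectNorm_nonneg _ _ _)).trans h.cfl

theorem abs_speed_le (h : SchemeStep klo khi ulo uhi γ₁ γ₂ lam κ f kd u) {a b : ℝ}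
    (ha : a ∈ Icc klo khi) (hb : b ∈ Icc ulo uhi) :
    |lam * partialU (Icc ulo uhi) f a b| ≤ κ := by
  rw [abs_mul, abs_of_pos h.lam_pos]
  exact (mul_le_mul_of_nonneg_left (h.flux.abs_partialU_le h.lo_lt_hi ha hb) h.lam_pos.le).trans
    h.cfl

theorem abs_speed_sub_le (h : SchemeStep klo khi ulo uhi γ₁ γ₂ lam κ f kd u) {a x y d : ℝ}
    (ha : a ∈ Icc klo khi) (hx : x ∈ Icc ulo uhi) (hy : y ∈ Icc ulo uhi) (hd : |y - x| ≤ d) :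
    |lam * partialU (Icc ulo uhi) f a y - lam * partialU (Icc ulo uhi) f a x|
      ≤ min (2 * κ) (lam * γ₂ * d) := by
  refine le_min ?_ ?_
  · have h1 := h.abs_speed_le ha hx
    have h2 := h.abs_speed_le ha hy
    rw [abs_le] at *
    constructor <;> linarith [h1.1, h1.2, h2.1, h2.2]
  · rw [← mul_sub, abs_mul, abs_of_pos h.lam_pos, mul_assoc]
    refine mul_le_mul_of_nonneg_left ?_ h.lam_pos.le
    exact ((h.flux.abs_partialU_sub_le_min h.lo_lt_hi ha hx hy).trans (min_le_right _ _)).trans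
      (mul_le_mul_of_nonneg_left hd h.gamma₂_pos.le)

theorem abs_speed_coef_sub_le (h : SchemeStep klo khi ulo uhi γ₁ γ₂ lam κ f kd u) {x : ℝ}
    (hx : x ∈ Icc ulo uhi) (j : ℤ) :
    |lam * partialU (Icc ulo uhi) f (kd (j + 1)) x - lam * partialU (Icc ulo uhi) f (kd j) x|
      ≤ min (2 * κ) (coefVar (lam * rectNorm (Icc klo khi) (Icc ulo uhi)
        (partialU (Icc ulo uhi) (partialK (Icc klo khi) f))) kd j) := by
  refine le_min ?_ ?_
  · have h1 := h.abs_speed_le (h.kd_mem j) hx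
    have h2 := h.abs_speed_le (h.kd_mem (j + 1)) hx
    rw [abs_le] at *
    constructor <;> linarith [h1.1, h1.2, h2.1, h2.2]
  · rw [← mul_sub, abs_mul, abs_of_pos h.lam_pos, coefVar, mul_assoc]
    exact mul_le_mul_of_nonneg_left
      (h.flux.abs_partialU_sub_le h.lo_lt_hi (h.kd_mem j) (h.kd_mem _) hx) h.lam_pos.le

theorem midValue_eq (lam : ℝ) (U : Set ℝ) (f : ℝ → ℝ → ℝ) (kd u : ℤ → ℝ) (j : ℤ) :
    midValue lam U f kd u j = u j + -(1 / 2 * cellSpeed lam U f kd u j) * mmSlope u j := by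
  unfold midValue cellSpeed; ring

theorem abs_cellSpeed_le (h : SchemeStep klo khi ulo uhi γ₁ γ₂ lam κ f kd u) (j : ℤ) :
    |cellSpeed lam (Icc ulo uhi) f kd u j| ≤ κ := h.abs_speed_le (h.kd_mem j) (h.u_mem j)

theorem midValue_mem (h : SchemeStep klo khi ulo uhi γ₁ γ₂ lam κ f kd u) (j : ℤ) :
    midValue lam (Icc ulo uhi) f kd u j ∈ Icc ulo uhi := by
  rw [midValue_eq]
  refine add_mul_mmSlope_mem h.u_mem j ?_
  have h1 := h.abs_cellSpeed_le j
  have h2 := h.kappa_le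
  rw [abs_neg, abs_mul, abs_of_pos (by norm_num : (0 : ℝ) < 1 / 2)]
  linarith

theorem abs_midValue_sub_le (h : SchemeStep klo khi ulo uhi γ₁ γ₂ lam κ f kd u) (j : ℤ) :
    |midValue lam (Icc ulo uhi) f kd u j - u j| ≤ 1 / 2 * κ * |mmSlope u j| := by
  rw [midValue_eq, add_sub_cancel_left, abs_mul, abs_neg, abs_mul,
    abs_of_pos (by norm_num : (0 : ℝ) < 1 / 2)]
  have := h.abs_cellSpeed_le j
  gcongr

/-- First-order expansion of the normalized flux at a mid-time value. -/
theorem abs_flux_midValue_sub_le (h : SchemeStep klo khi ulo uhi γ₁ γ₂ lam κ f kd u) {a d : ℝ}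
    (ha : a ∈ Icc klo khi) (j : ℤ) (hd : |mmSlope u j| ≤ d) :
    |lam * f a (midValue lam (Icc ulo uhi) f kd u j) - lam * f a (u j)
      + 1 / 2 * (lam * partialU (Icc ulo uhi) f a (u j)) * cellSpeed lam (Icc ulo uhi) f kd u j
        * mmSlope u j| ≤ 1 / 2 * κ * min (2 * κ) (lam * γ₂ * d) * d := by
  have hκ := h.kappa_nonneg
  have hl := h.lam_pos.le
  have hγ := h.gamma₂_pos.le
  have hd0 : 0 ≤ d := (abs_nonneg _).trans hd
  have ht := h.flux.abs_taylor_le h.lo_lt_hi ha (h.u_mem j) (h.midValue_mem j)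
  have hm : |midValue lam (Icc ulo uhi) f kd u j - u j| ≤ 1 / 2 * κ * d :=
    (h.abs_midValue_sub_le j).trans (by gcongr)
  have hm' : |midValue lam (Icc ulo uhi) f kd u j - u j| ≤ d := hm.trans (by
    have := h.kappa_le
    nlinarith)
  set y := midValue lam (Icc ulo uhi) f kd u j with hy
  have e : lam * f a y - lam * f a (u j) + 1 / 2 * (lam * partialU (Icc ulo uhi) f a (u j))
      * cellSpeed lam (Icc ulo uhi) f kd u j * mmSlope u j
      = lam * (f a y - f a (u j) - partialU (Icc ulo uhi) f a (u j) * (y - u j)) := by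
    rw [hy, midValue_eq]; ring
  rw [e, abs_mul, abs_of_pos h.lam_pos]
  calc lam * |f a y - f a (u j) - partialU (Icc ulo uhi) f a (u j) * (y - u j)|
      ≤ lam * (min (2 * rectNorm (Icc klo khi) (Icc ulo uhi) (partialU (Icc ulo uhi) f))
        (γ₂ * |y - u j|) * |y - u j|) := mul_le_mul_of_nonneg_left ht hl
    _ = min (2 * (lam * rectNorm (Icc klo khi) (Icc ulo uhi) (partialU (Icc ulo uhi) f)))
        (lam * γ₂ * |y - u j|) * |y - u j| := by
          rw [← mul_assoc, mul_min_of_nonneg _ _ hl]; congr 2 <;> ring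
    _ ≤ min (2 * κ) (lam * γ₂ * d) * (1 / 2 * κ * d) := by
          have hlg : 0 ≤ lam * γ₂ := mul_nonneg hl hγ
          refine mul_le_mul (min_le_min ?_ (mul_le_mul_of_nonneg_left hm' hlg)) hm (abs_nonneg _)
            (le_min (by positivity) (by positivity))
          linarith [h.cfl]
    _ = _ := by ring

theorem abs_midFlux_le (h : SchemeStep klo khi ulo uhi γ₁ γ₂ lam κ f kd u) (j : ℤ) :
    |midFlux lam (Icc ulo uhi) f kd u j| ≤ 1 / 1000 * |u (j + 1) - u j| := by
  have hκ := h.kappa_nonneg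
  have hκ1 := h.kappa_le
  have h1 := h.flux.abs_sub_le h.lo_lt_hi (h.kd_mem j) (h.midValue_mem j) (h.midValue_mem (j + 1))
  have m1 := h.abs_midValue_sub_le j
  have m2 := h.abs_midValue_sub_le (j + 1)
  have s1 := (abs_mmSlope_le u j).1
  have s2 := (abs_mmSlope_le u (j + 1)).2
  rw [add_sub_cancel_right] at s2
  have hD := abs_nonneg (u (j + 1) - u j)
  have hb : |midValue lam (Icc ulo uhi) f kd u (j + 1) - midValue lam (Icc ulo uhi) f kd u j|
      ≤ 2 * |u (j + 1) - u j| := by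
    have t1 : 1 / 2 * κ * |mmSlope u j| ≤ 1 / 2 * |u (j + 1) - u j| := by
      have := mul_le_mul (by linarith : 1 / 2 * κ ≤ 1 / 2) s1 (abs_nonneg _) (by norm_num)
      linarith
    have t2 : 1 / 2 * κ * |mmSlope u (j + 1)| ≤ 1 / 2 * |u (j + 1) - u j| := by
      have := mul_le_mul (by linarith : 1 / 2 * κ ≤ 1 / 2) s2 (abs_nonneg _) (by norm_num)
      linarith
    have d1 := abs_le.1 (m1.trans t1)
    have d2 := abs_le.1 (m2.trans t2)
    have d3 := abs_le.1 (le_refl |u (j + 1) - u j|)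
    rw [abs_le]
    constructor <;> linarith [d1.1, d1.2, d2.1, d2.2, d3.1, d3.2]
  unfold midFlux
  rw [abs_mul, abs_of_pos h.lam_pos]
  calc lam * |f (kd j) (midValue lam (Icc ulo uhi) f kd u (j + 1))
        - f (kd j) (midValue lam (Icc ulo uhi) f kd u j)|
      ≤ lam * (rectNorm (Icc klo khi) (Icc ulo uhi) (partialU (Icc ulo uhi) f)
        * (2 * |u (j + 1) - u j|)) := by
        refine mul_le_mul_of_nonneg_left (h1.trans ?_) h.lam_pos.le
        exact mul_le_mul_of_nonneg_left hb (rectNorm_nonneg _ _ _)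
    _ = (lam * rectNorm (Icc klo khi) (Icc ulo uhi) (partialU (Icc ulo uhi) f))
        * (2 * |u (j + 1) - u j|) := by ring
    _ ≤ 1 / 4000 * (2 * |u (j + 1) - u j|) :=
        mul_le_mul_of_nonneg_right (h.cfl.trans hκ1) (by positivity)
    _ ≤ _ := by linarith

/-- The mean speed over a positive jump is attained. -/
theorem exists_jumpSpeed_eq (h : SchemeStep klo khi ulo uhi γ₁ γ₂ lam κ f kd u) {j : ℤ}
    (hj : 0 < posJump u j) : ∃ t ∈ Ioo (u j) (u (j + 1)),
      jumpSpeed lam f kd u j = lam * partialU (Icc ulo uhi) f (kd j) t := by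
  have he := posJump_eq hj
  obtain ⟨t, ht, hs⟩ := h.flux.exists_slope (h.kd_mem j) (h.u_mem j) (h.u_mem (j + 1))
    (by linarith)
  refine ⟨t, ht, ?_⟩
  rw [jumpSpeed, if_pos hj, hs, ← he, mul_div_cancel_right₀ _ hj.ne']

theorem jumpSpeed_mul (h : SchemeStep klo khi ulo uhi γ₁ γ₂ lam κ f kd u) {j : ℤ}
    (hj : 0 < posJump u j) : jumpSpeed lam f kd u j * posJump u j
      = lam * f (kd j) (u (j + 1)) - lam * f (kd j) (u j) := by
  have := h.lam_pos
  rw [jumpSpeed, if_pos hj]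
  field_simp

theorem jumpFlux_expansion (h : SchemeStep klo khi ulo uhi γ₁ γ₂ lam κ f kd u) (j : ℤ)
    {μ : ℤ → ℝ} (hμ : μ = coefVar (lam * rectNorm (Icc klo khi) (Icc ulo uhi)
      (partialU (Icc ulo uhi) (partialK (Icc klo khi) f))) kd)
    (hj : 0 < posJump u j) :
    |jumpFlux lam (Icc ulo uhi) f kd u j - (jumpSpeed lam f kd u j * posJump u j
      - 4 * cellSpeed lam (Icc ulo uhi) f kd u j ^ 2 * recon (posJump u) j)|
      ≤ 2 * κ * speedVar κ (lam * γ₂) (posJump u) μ j * posJump u j := by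
  have hκ := h.kappa_nonneg
  have he := posJump_eq hj
  have hpos : 0 < u (j + 1) - u j := he ▸ hj
  have s1 := (abs_mmSlope_le u j).1
  have s2 := (abs_mmSlope_le u (j + 1)).2
  rw [add_sub_cancel_right] at s2
  rw [abs_of_pos hpos, ← he] at s1 s2
  have r1 := h.abs_flux_midValue_sub_le (h.kd_mem j) j s1
  have r2 := h.abs_flux_midValue_sub_le (h.kd_mem j) (j + 1) s2
  have q1 := h.abs_speed_sub_le (h.kd_mem j) (h.u_mem j) (h.u_mem (j + 1)) (d := posJump u j)
    (by rw [abs_of_pos hpos, he])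
  have q2 := h.abs_speed_coef_sub_le (h.u_mem (j + 1)) j
  rw [← hμ] at q2
  have b1 := h.abs_speed_le (h.kd_mem j) (h.u_mem (j + 1))
  have b2 := h.abs_cellSpeed_le j
  have b3 := h.abs_cellSpeed_le (j + 1)
  rw [jumpFlux, if_pos hj, h.jumpSpeed_mul hj, recon_posJump hpos, midFlux]
  set c := cellSpeed lam (Icc ulo uhi) f kd u j with hc
  set c₁ := cellSpeed lam (Icc ulo uhi) f kd u (j + 1) with hc₁
  set c' := lam * partialU (Icc ulo uhi) f (kd j) (u (j + 1)) with hc'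
  rw [show lam * partialU (Icc ulo uhi) f (kd j) (u j) = c from rfl] at r1 q1
  rw [show lam * partialU (Icc ulo uhi) f (kd (j + 1)) (u (j + 1)) = c₁ from rfl] at q2
  set A := min (2 * κ) (lam * γ₂ * posJump u j) with hA
  set B := min (2 * κ) (μ j) with hB
  have hA0 : 0 ≤ A := (abs_nonneg _).trans q1
  have hB0 : 0 ≤ B := (abs_nonneg _).trans q2
  have hsv : speedVar κ (lam * γ₂) (posJump u) μ j = A + B := rfl
  rw [hsv]
  -- The Taylor term at cell j + 1 carries c'c₁ instead of c². Here c' - c is a change of u at fixed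
  -- coefficient (bound A), c₁ - c' a change of coefficient at fixed u (bound B).
  have q3 : |(c' * c₁ - c ^ 2) * mmSlope u (j + 1)| ≤ κ * (2 * (A + B)) * posJump u j := by
    have e : c' * c₁ - c ^ 2 = c₁ * (c' - c) + c * ((c₁ - c') + (c' - c)) := by ring
    rw [e, abs_mul]
    refine mul_le_mul ?_ s2 (abs_nonneg _) (by positivity)
    calc |c₁ * (c' - c) + c * ((c₁ - c') + (c' - c))|
        ≤ |c₁| * |c' - c| + |c| * (|c₁ - c'| + |c' - c|) := by
          refine (abs_add_le _ _).trans ?_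
          rw [abs_mul, abs_mul]
          exact add_le_add_right (mul_le_mul_of_nonneg_left (abs_add_le _ _) (abs_nonneg _)) _
      _ ≤ κ * A + κ * (B + A) := by gcongr
      _ ≤ κ * (2 * (A + B)) := by nlinarith
  set P := posJump u j with hP
  have hBP : 0 ≤ κ * B * P := by positivity
  have hAP : 0 ≤ κ * A * P := by positivity
  rw [abs_le] at r1 r2 q3 ⊢
  constructor
  · linarith [r1.1, r1.2, r2.1, r2.2, q3.1, q3.2]
  · linarith [r1.1, r1.2, r2.1, r2.2, q3.1, q3.2]

/-- One step of the scheme provides the estimates of `ConvexStep`. -/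
theorem convexStep (h : SchemeStep klo khi ulo uhi γ₁ γ₂ lam κ f kd u)
    (hp : SqSummable (posJump u)) {μ : ℤ → ℝ}
    (hμ : μ = coefVar (lam * rectNorm (Icc klo khi) (Icc ulo uhi)
      (partialU (Icc ulo uhi) (partialK (Icc klo khi) f))) kd) (hμs : Summable μ) :
    ConvexStep (posJump u) (cellSpeed lam (Icc ulo uhi) f kd u) (jumpSpeed lam f kd u)
      (jumpFlux lam (Icc ulo uhi) f kd u) (speedVar κ (lam * γ₂) (posJump u) μ) μ κ (lam * γ₁)
      (lam * γ₂) (uhi - ulo) := by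
  have hκ := h.kappa_nonneg
  have hl := h.lam_pos
  have hγ₁ := h.flux.gamma_pos
  have hγ₂ := h.gamma₂_pos
  have hp0 := posJump_nonneg u
  have hμ0 : ∀ j, 0 ≤ μ j := fun j => by
    rw [hμ]; exact coefVar_nonneg (mul_nonneg hl.le (rectNorm_nonneg _ _ _)) kd j
  have hA0 : ∀ j, 0 ≤ min (2 * κ) (lam * γ₂ * posJump u j) := fun j =>
    le_min (by linarith) (by have := hp0 j; positivity)
  have hB0 : ∀ j, 0 ≤ min (2 * κ) (μ j) := fun j => le_min (by linarith) (hμ0 j)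
  have hcoef : ∀ j, |lam * partialU (Icc ulo uhi) f (kd (j + 1)) (u (j + 1))
      - lam * partialU (Icc ulo uhi) f (kd j) (u (j + 1))| ≤ min (2 * κ) (μ j) := fun j => by
    rw [hμ]; exact h.abs_speed_coef_sub_le (h.u_mem (j + 1)) j
  have hend : ∀ j, 0 < posJump u j → lam * γ₁ * posJump u j
      ≤ lam * partialU (Icc ulo uhi) f (kd j) (u (j + 1))
        - lam * partialU (Icc ulo uhi) f (kd j) (u j) := fun j hj => by
    have he := posJump_eq hj
    have := (h.flux.partialU_sub h.lo_lt_hi (h.kd_mem j) (h.u_mem j) (h.u_mem (j + 1))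
      (by linarith)).1
    rw [← he] at this
    have := mul_le_mul_of_nonneg_left this hl.le
    linarith
  have hvle : ∀ j, |jumpSpeed lam f kd u j| ≤ κ := fun j => by
    by_cases hj : 0 < posJump u j
    · obtain ⟨t, ht, e⟩ := h.exists_jumpSpeed_eq hj
      rw [e]
      exact h.abs_speed_le (h.kd_mem j)
        ⟨(h.u_mem j).1.trans ht.1.le, ht.2.le.trans (h.u_mem (j + 1)).2⟩
    · rw [jumpSpeed, if_neg hj, abs_zero]; exact hκ
  refine ⟨hp0, fun j => ?_, hp, h.kappa_le, by positivity, by positivity, ?_, fun j => ?_,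
    h.abs_cellSpeed_le, hvle, hμ0, hμs, fun j => add_nonneg (hA0 j) (hB0 j), fun j => ?_,
    fun j => add_le_add (min_le_right _ _) (min_le_right _ _), fun j hj => ?_, fun j hj => ?_,
    fun j hj => ?_, fun j hj => ?_, fun j hj hj' => ?_, fun j => ?_⟩
  · linarith [posJump_add_le h.u_mem j, hp0 (j - 1)]
  · have := h.kappa_le'
    rw [le_div_iff₀ (by positivity)] at this
    have := mul_le_mul_of_nonneg_left this hl.le
    linarith
  · rcases (hp0 j).eq_or_lt with h0 | h0
    · rw [← h0, mul_zero]; linarith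
    · have h1 := abs_le.1 (h.abs_speed_le (h.kd_mem j) (h.u_mem j))
      have h2 := abs_le.1 (h.abs_speed_le (h.kd_mem j) (h.u_mem (j + 1)))
      linarith [hend j h0, h1.1, h2.2]
  · unfold speedVar
    linarith [min_le_left (2 * κ) (lam * γ₂ * posJump u j), min_le_left (2 * κ) (μ j)]
  · obtain ⟨t, ht, e⟩ := h.exists_jumpSpeed_eq hj
    have he := posJump_eq hj
    rw [e]
    refine (h.abs_speed_sub_le (h.kd_mem j) (h.u_mem j)
      ⟨(h.u_mem j).1.trans ht.1.le, ht.2.le.trans (h.u_mem (j + 1)).2⟩ ?_).trans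
      (le_add_of_nonneg_right (hB0 j))
    rw [abs_of_pos (by linarith [ht.1]), he]; linarith [ht.2]
  · obtain ⟨t, ht, e⟩ := h.exists_jumpSpeed_eq hj
    have he := posJump_eq hj
    have h1 := h.abs_speed_sub_le (h.kd_mem j) (h.u_mem (j + 1)) (d := posJump u j)
      ⟨(h.u_mem j).1.trans ht.1.le, ht.2.le.trans (h.u_mem (j + 1)).2⟩ (by
        rw [abs_of_neg (by linarith [ht.2]), he]; linarith [ht.1])
    have h2 := hcoef j
    rw [abs_sub_comm] at h2
    rw [e, cellSpeed]
    exact (abs_sub_le _ _ _).trans (add_le_add h1 h2)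
  · have he := posJump_eq hj
    have h1 := h.abs_speed_sub_le (h.kd_mem j) (h.u_mem j) (h.u_mem (j + 1)) (d := posJump u j)
      (by rw [← he, abs_of_pos hj])
    rw [cellSpeed, cellSpeed, speedVar, add_comm (min _ _)]
    exact (abs_sub_le _ _ _).trans (add_le_add (hcoef j) h1)
  · have h1 := abs_le.1 ((hcoef j).trans (min_le_right _ _))
    have h2 := hend j hj
    have h3 : 0 ≤ lam * γ₁ * posJump u j := by positivity
    rw [cellSpeed, cellSpeed]
    linarith [h1.1]
  -- Both mean slopes are compared with f_u at the common state u_{j+1}: from below it by γ₁p_j/2 on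
  -- the left, from above by γ₁p_{j+1}/2 on the right. The change of coefficient there costs μ_j.
  · have he := posJump_eq hj
    have he' := posJump_eq hj'
    have h1 := (h.flux.strong_convexity h.lo_lt_hi (h.kd_mem j) (h.u_mem j) (h.u_mem (j + 1))
      (by linarith)).2
    have h2 := (h.flux.strong_convexity h.lo_lt_hi (h.kd_mem (j + 1)) (h.u_mem (j + 1))
      (h.u_mem (j + 1 + 1)) (by linarith)).1
    rw [← he, ← div_le_iff₀ hj] at h1
    rw [← he', ← le_div_iff₀ hj'] at h2
    have h3 := abs_le.1 ((hcoef j).trans (min_le_right _ _))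
    rw [jumpSpeed, jumpSpeed, if_pos hj, if_pos hj']
    have h4 := mul_le_mul_of_nonneg_left h1 hl.le
    have h5 := mul_le_mul_of_nonneg_left h2 hl.le
    linarith [h3.1]
  · by_cases hj : 0 < posJump u j
    · exact h.jumpFlux_expansion j hμ hj
    · have h0 : posJump u j = 0 := le_antisymm (not_lt.1 hj) (hp0 j)
      have hr := abs_recon_le hp0 j
      rw [h0, mul_zero, abs_nonpos_iff] at hr
      rw [jumpFlux, if_neg hj, hr, h0]
      simp

end SchemeStep

/-! ### From the scheme to the positive jumps -/

namespace SchemeStep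

variable {klo khi ulo uhi γ₁ γ₂ lam κ : ℝ} {f : ℝ → ℝ → ℝ} {kd u : ℤ → ℝ}

/-- The weighted variation of the coefficient, which bounds its effect on the flux increments. -/
def fluxVar (lam klo khi ulo uhi : ℝ) (f : ℝ → ℝ → ℝ) (kd : ℤ → ℝ) : ℤ → ℝ :=
  coefVar (lam * rectNorm (Icc klo khi) (Icc ulo uhi) (partialK (Icc klo khi) f)) kd

theorem fluxVar_nonneg (h : SchemeStep klo khi ulo uhi γ₁ γ₂ lam κ f kd u) (j : ℤ) :
    0 ≤ fluxVar lam klo khi ulo uhi f kd j :=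
  coefVar_nonneg (mul_nonneg h.lam_pos.le (rectNorm_nonneg _ _ _)) kd j

/-- A new jump splits at the old value u_j into two half jumps, each depending on one old jump only.
The flux difference is split at the right mid-time value, which isolates the effect of the
coefficient. -/
theorem schemeStep_half_bounds (h : SchemeStep klo khi ulo uhi γ₁ γ₂ lam κ f kd u) (j : ℤ) :
    schemeStep lam (Icc ulo uhi) f kd u j - u j
        ≤ 1 / 2 * posJump u j - (recon (posJump u) j + jumpFlux lam (Icc ulo uhi) f kd u j)
          + fluxVar lam klo khi ulo uhi f kd j ∧
      u (j + 1) - schemeStep lam (Icc ulo uhi) f kd u j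
        ≤ 1 / 2 * posJump u j + (recon (posJump u) j + jumpFlux lam (Icc ulo uhi) f kd u j)
          + fluxVar lam klo khi ulo uhi f kd j := by
  set m := midValue lam (Icc ulo uhi) f kd u (j + 1) with hm
  have hη : |lam * (f (kd (j + 1)) m - f (kd j) m)| ≤ fluxVar lam klo khi ulo uhi f kd j := by
    rw [abs_mul, abs_of_pos h.lam_pos, fluxVar, coefVar, mul_assoc]
    exact mul_le_mul_of_nonneg_left
      (h.flux.abs_sub_le_partialK (h.kd_mem j) (h.kd_mem _) (h.midValue_mem _)) h.lam_pos.le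
  obtain ⟨hη1, hη2⟩ := abs_le.1 hη
  have hs : schemeStep lam (Icc ulo uhi) f kd u j = u j + 1 / 2 * (u (j + 1) - u j)
      - 1 / 8 * (mmSlope u (j + 1) - mmSlope u j) - midFlux lam (Icc ulo uhi) f kd u j
      - lam * (f (kd (j + 1)) m - f (kd j) m) := by
    rw [schemeStep, midFlux, ← hm]; ring
  have hφ := h.abs_midFlux_le j
  rcases lt_or_ge 0 (u (j + 1) - u j) with hj | hj
  · have hp : posJump u j = u (j + 1) - u j := max_eq_left hj.le
    rw [recon_posJump hj, jumpFlux, if_pos (hp ▸ hj), hp, hs]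
    constructor <;> linarith
  -- For a jump d ≤ 0 the half d/2 dominates the slope term (at most |d|/8) and the flux term (at
  -- most |d|/1000), so both half jumps are nonpositive up to the coefficient error.
  · have hp : posJump u j = 0 := max_eq_right hj
    have hr := abs_recon_le (posJump_nonneg u) j
    rw [hp, mul_zero, abs_nonpos_iff] at hr
    rw [abs_of_nonpos hj] at hφ
    obtain ⟨h1, h2⟩ := abs_le.1 hφ
    have s1 := (mmSlope_bounds u j).1
    have s2 := (mmSlope_bounds u (j + 1)).2
    rw [add_sub_cancel_right] at s2
    rw [min_eq_left hj, max_eq_right hj] at s1 s2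
    rw [hr, jumpFlux, if_neg (by rw [hp]; exact lt_irrefl 0), hp, hs]
    constructor <;> linarith [s1.1, s1.2, s2.1, s2.2]

theorem sq_jump_le (h : SchemeStep klo khi ulo uhi γ₁ γ₂ lam κ f kd u)
    (he : ∀ j, |recon (posJump u) j + jumpFlux lam (Icc ulo uhi) f kd u j|
      ≤ 1 / 2 * posJump u j) {B : ℝ} (hB : ∀ j, fluxVar lam klo khi ulo uhi f kd j ≤ B) (j : ℤ) :
    max (schemeStep lam (Icc ulo uhi) f kd u j - schemeStep lam (Icc ulo uhi) f kd u (j - 1)) 0 ^ 2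
      ≤ (1 / 2 * (posJump u (j - 1) + posJump u j)
        - ((recon (posJump u) j + jumpFlux lam (Icc ulo uhi) f kd u j)
          - (recon (posJump u) (j - 1) + jumpFlux lam (Icc ulo uhi) f kd u (j - 1)))) ^ 2
        + (2 * (uhi - ulo) + 2 * B)
          * (fluxVar lam klo khi ulo uhi f kd j + fluxVar lam klo khi ulo uhi f kd (j - 1)) := by
  have h1 := (h.schemeStep_half_bounds j).1
  have h2 := (h.schemeStep_half_bounds (j - 1)).2
  rw [sub_add_cancel] at h2
  have e1 := abs_le.1 (he j)
  have e2 := abs_le.1 (he (j - 1))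
  have hW := posJump_add_le h.u_mem j
  have n1 := h.fluxVar_nonneg j
  have n2 := h.fluxVar_nonneg (j - 1)
  have b1 := hB j
  have b2 := hB (j - 1)
  set X := 1 / 2 * (posJump u (j - 1) + posJump u j)
        - ((recon (posJump u) j + jumpFlux lam (Icc ulo uhi) f kd u j)
          - (recon (posJump u) (j - 1) + jumpFlux lam (Icc ulo uhi) f kd u (j - 1))) with hX
  set ε := fluxVar lam klo khi ulo uhi f kd j + fluxVar lam klo khi ulo uhi f kd (j - 1) with hε
  have hX0 : 0 ≤ X := by linarith [e1.2, e2.1]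
  -- With |e| ≤ p/2 the quantity X is at most p_{j-1} + p_j, and two consecutive positive jumps
  -- together fit into the interval.
  have hX1 : X ≤ uhi - ulo := by linarith [e1.1, e2.2]
  have hε0 : 0 ≤ ε := by linarith
  have hle : max (schemeStep lam (Icc ulo uhi) f kd u j
      - schemeStep lam (Icc ulo uhi) f kd u (j - 1)) 0 ≤ X + ε :=
    max_le (by linarith) (by linarith)
  calc _ ≤ (X + ε) ^ 2 := pow_le_pow_left₀ (le_max_right _ _) hle 2
    _ ≤ X ^ 2 + (2 * (uhi - ulo) + 2 * B) * ε := by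
        have t1 := mul_le_mul_of_nonneg_right hX1 hε0
        have t2 := mul_le_mul_of_nonneg_right (by linarith : ε ≤ 2 * B) hε0
        nlinarith

/-- The one-sided `ℓ²` estimate for one step of the scheme. -/
theorem sum_sq_jump_le (h : SchemeStep klo khi ulo uhi γ₁ γ₂ lam κ f kd u)
    (hp : SqSummable (posJump u)) (hkd : Summable fun j => |kd (j + 1) - kd j|) {nk : ℝ}
    (hnk : ∀ j, |kd j| ≤ nk) {nfk nfku : ℝ}
    (hnfk : nfk = rectNorm (Icc klo khi) (Icc ulo uhi) (partialK (Icc klo khi) f))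
    (hnfku : nfku = rectNorm (Icc klo khi) (Icc ulo uhi)
      (partialU (Icc ulo uhi) (partialK (Icc klo khi) f))) {u' : ℤ → ℝ}
    (hu' : ∀ j, u' j = schemeStep lam (Icc ulo uhi) f kd u j) :
    (Summable fun j => max (u' j - u' (j - 1)) 0 ^ 2) ∧
      (Summable fun j => posJump u j ^ 3) ∧
      ∑' j, max (u' j - u' (j - 1)) 0 ^ 2
        ≤ ∑' j, posJump u j ^ 2 - 1 / 500 * (lam * γ₁) * ∑' j, posJump u j ^ 3
          + (2 * (uhi - ulo) ^ 2 * (lam * nfku)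
            + (4 * (uhi - ulo) + 8 * lam * nfk * nk) * (lam * nfk))
            * ∑' j, |kd (j + 1) - kd j| := by
  set μ := coefVar (lam * nfku) kd with hμ
  set ν := fluxVar lam klo khi ulo uhi f kd with hν
  have hνe : ν = coefVar (lam * nfk) kd := by rw [hν, fluxVar, hnfk]
  have hμs : Summable μ := hkd.mul_left _
  have hνs : Summable ν := by rw [hνe]; exact hkd.mul_left _
  have hc := h.convexStep hp (μ := μ) (by rw [hμ, hnfku]) hμs
  have hnfk0 : 0 ≤ nfk := by rw [hnfk]; exact rectNorm_nonneg _ _ _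
  have hB : ∀ j, ν j ≤ 2 * (lam * nfk * nk) := fun j => by
    rw [hνe, coefVar]
    have : |kd (j + 1) - kd j| ≤ 2 * nk := by
      rw [abs_le]
      have h1 := abs_le.1 (hnk j)
      have h2 := abs_le.1 (hnk (j + 1))
      constructor <;> linarith [h1.1, h1.2, h2.1, h2.2]
    have := mul_le_mul_of_nonneg_left this (mul_nonneg h.lam_pos.le hnfk0)
    linarith
  have he : ∀ j, |recon (posJump u) j + jumpFlux lam (Icc ulo uhi) f kd u j|
      ≤ 1 / 2 * posJump u j := fun j => by
    have h1 := abs_recon_le (posJump_nonneg u) j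
    have h2 := hc.abs_phi_le j
    have := posJump_nonneg u j
    linarith [abs_add_le (recon (posJump u) j) (jumpFlux lam (Icc ulo uhi) f kd u j)]
  set R := 2 * (uhi - ulo) + 2 * (2 * (lam * nfk * nk)) with hR
  have hνs' : Summable fun j => ν (j - 1) := summable_int_shift hνs (-1)
  have hεs : Summable fun j => R * (ν j + ν (j - 1)) := (hνs.add hνs').mul_left R
  have h3 := hc.summable_cube
  have t := hc.telescopeLE_sq.add (TelescopeLE.of_le (X := fun j => R * (ν j + ν (j - 1)))
    (fun _ => le_rfl))
  have t' : TelescopeLE (fun j => max (u' j - u' (j - 1)) 0 ^ 2) _ :=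
    (TelescopeLE.of_le fun j => by
      rw [hu', hu']; exact h.sq_jump_le he hB j).trans t
  have y1 : Summable fun j => posJump u j ^ 2 := hp
  have y2 : Summable fun j => 1 / 500 * (lam * γ₁) * posJump u j ^ 3 := h3.mul_left _
  have y3 : Summable fun j => 2 * (uhi - ulo) ^ 2 * μ j := hμs.mul_left _
  have hX := t'.summable (fun j => sq_nonneg _) (((y1.sub y2).add y3).add hεs)
  refine ⟨hX, h3, (t'.tsum_le hX (((y1.sub y2).add y3).add hεs)).trans (le_of_eq ?_)⟩
  have z1 : ∑' j, μ j = lam * nfku * ∑' j, |kd (j + 1) - kd j| := tsum_mul_left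
  have z2 : ∑' j, ν j = lam * nfk * ∑' j, |kd (j + 1) - kd j| := by rw [hνe]; exact tsum_mul_left
  have z3 : ∑' j, ν (j - 1) = ∑' j, ν j := tsum_int_shift ν (-1)
  rw [((y1.sub y2).add y3).tsum_add hεs, (y1.sub y2).tsum_add y3, y1.tsum_sub y2, tsum_mul_left,
    tsum_mul_left, tsum_mul_left, hνs.tsum_add hνs', z3, z1, z2]
  ring

end SchemeStep

/-! ### Assembly and comparison of constants -/

theorem mainTheorem6
    (klo khi ulo uhi γ₁ γ₂ : ℝ) (hk : klo ≤ khi) (hu : ulo ≤ uhi)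
    (f : ℝ → ℝ → ℝ) (hf : IsConvexFlux klo khi ulo uhi γ₁ γ₂ f)
    (k : ℝ → ℝ) (hkBV : IsCoefficient klo khi k)
    (dx dt lam : ℝ) (hdx : 0 < dx) (hdt : 0 < dt) (hlam : lam = dt / dx) (x₀ : ℝ)
    (nfu nfk nfuk nfku C : ℝ)
    (hnfu : nfu = rectNorm (Icc klo khi) (Icc ulo uhi) (partialU (Icc ulo uhi) f))
    (hnfk : nfk = rectNorm (Icc klo khi) (Icc ulo uhi) (partialK (Icc klo khi) f))
    (hnfuk : nfuk = rectNorm (Icc klo khi) (Icc ulo uhi)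
      (partialK (Icc klo khi) (partialU (Icc ulo uhi) f)))
    (hnfku : nfku = rectNorm (Icc klo khi) (Icc ulo uhi)
      (partialU (Icc ulo uhi) (partialK (Icc klo khi) f)))
    (hC : C = max |ulo| |uhi|)
    (κ : ℝ) (hκ : lam * nfu ≤ κ) (hCFL : κ ≤ min (γ₁ / (7500 * γ₂)) (1 / 4000))
    (u u' : ℤ → ℝ) (hmem : ∀ j, u j ∈ Icc ulo uhi)
    (hstep : ∀ j, u' j = schemeStep lam (Icc ulo uhi) f (cellAverage dx x₀ k) u j) :
    (Summable fun j : ℤ => (max (u j - u (j - 1)) 0) ^ 2) →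
    (Summable fun j : ℤ => (max (u' j - u' (j - 1)) 0) ^ 2) ∧
    (Summable fun j : ℤ => (max (u j - u (j - 1)) 0) ^ 3) ∧
    ∑' j : ℤ, (max (u' j - u' (j - 1)) 0) ^ 2 ≤
      ∑' j : ℤ, (max (u j - u (j - 1)) 0) ^ 2
        - 1 / 500 * lam * γ₁ * ∑' j : ℤ, (max (u j - u (j - 1)) 0) ^ 3
        + oslConst lam C γ₂ nfu nfk nfuk nfku (supNorm k) * bvNorm k := by
  intro hs
  have hlam0 : 0 < lam := by rw [hlam]; positivity
  have hS : SchemeStep klo khi ulo uhi γ₁ γ₂ lam κ f (cellAverage dx x₀ k) u :=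
    { flux := hf
      lo_lt_hi := hf.lo_lt_hi hk hu
      lam_pos := hlam0
      kd_mem := cellAverage_bounds hkBV.memLp hkBV.mem_Icc hdx x₀
      u_mem := hmem
      cfl := hnfu ▸ hκ
      kappa_le := hCFL.trans (min_le_right _ _)
      kappa_le' := hCFL.trans (min_le_left _ _) }
  -- The theorem uses backward differences, `posJump` forward ones; the shift by one does not change
  -- the sums.
  have hpe : ∀ j, max (u j - u (j - 1)) 0 = posJump u (j + -1) := fun j => by
    rw [posJump, neg_add_cancel_right, ← sub_eq_add_neg]
  have hp : SqSummable (posJump u) := by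
    refine (summable_int_shift hs 1).congr fun j => ?_
    rw [add_sub_cancel_right, posJump]
  obtain ⟨r1, r2, r3⟩ := hS.sum_sq_jump_le hp (hkBV.summable_abs_sub hdx x₀)
    (abs_cellAverage_le hkBV.memLp hdx x₀) hnfk hnfku hstep
  simp only [hpe]
  rw [tsum_int_shift (fun j => posJump u j ^ 2) (-1), tsum_int_shift (fun j => posJump u j ^ 3) (-1)]
  refine ⟨r1, summable_int_shift r2 (-1), r3.trans ?_⟩
  have hV := hkBV.tsum_abs_sub_le hdx x₀
  set V := ∑' j : ℤ, |cellAverage dx x₀ k (j + 1) - cellAverage dx x₀ k j|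
  have hnfu0 : 0 ≤ nfu := by rw [hnfu]; exact rectNorm_nonneg _ _ _
  have hnfk0 : 0 ≤ nfk := by rw [hnfk]; exact rectNorm_nonneg _ _ _
  have hnfuk0 : 0 ≤ nfuk := by rw [hnfuk]; exact rectNorm_nonneg _ _ _
  have hnfku0 : 0 ≤ nfku := by rw [hnfku]; exact rectNorm_nonneg _ _ _
  have hnk0 : 0 ≤ supNorm k := ENNReal.toReal_nonneg
  have hbv0 : 0 ≤ bvNorm k := ENNReal.toReal_nonneg
  have hγ₂ : 0 ≤ γ₂ := hS.gamma₂_pos.le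
  have hC0 : 0 ≤ C := by rw [hC]; exact (abs_nonneg _).trans (le_max_left _ _)
  have hW0 : 0 ≤ uhi - ulo := by linarith
  have hW : uhi - ulo ≤ 2 * C := by
    have h1 : |ulo| ≤ C := hC ▸ le_max_left _ _
    have h2 : |uhi| ≤ C := hC ▸ le_max_right _ _
    linarith [neg_abs_le ulo, le_abs_self uhi]
  have hconst : 2 * (uhi - ulo) ^ 2 * (lam * nfku)
      + (4 * (uhi - ulo) + 8 * lam * nfk * supNorm k) * (lam * nfk)
      ≤ oslConst lam C γ₂ nfu nfk nfuk nfku (supNorm k) := by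
    -- With uhi - ulo ≤ 2C the coefficients obtained are 8, 8 and 8, against 114, 88 and 64 in Ψ;
    -- `p1`, `p2`, `p3` are the nonnegative surplus.
    calc _ ≤ 2 * (2 * C) ^ 2 * (lam * nfku)
        + (4 * (2 * C) + 8 * lam * nfk * supNorm k) * (lam * nfk) := by gcongr
      _ ≤ _ := by
        unfold oslConst
        have p1 : 0 ≤ 72 * lam ^ 2 * C ^ 2 * nfuk
            + (708 * C ^ 2 + 48 * lam * nfu) * lam ^ 2 * nfu * nfuk := by positivity
        have p2 : 0 ≤ (48 * lam ^ 2 * C * supNorm k + 132 * lam ^ 2 * C ^ 2 * γ₂ * nfu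
            + 56 * lam * nfk * supNorm k + 80 * C) * lam * nfk := by positivity
        have p3 : 0 ≤ 106 * lam * C ^ 2 * nfku := by positivity
        linarith
  have hfin := mul_le_mul hconst hV (tsum_nonneg fun _ => abs_nonneg _)
    (le_trans (by positivity) hconst)
  linarith

end
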